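/- **Setting.** Let $\mathbb F_q$ be a finite field, $\ell\ge 1$, $\alpha_1,\dots,\alpha_n\in\mathbb F_q$ distinct, $\lambda_1,\dots,\lambda_n\ge 1$, $L=\sum_j\lambda_j$, and let $d_f,d_g\ge 1$ satisfy $d_f+d_g\le L+1$. Write $\partial$ for the degree, and for vectors for the maximal degree of the entries. Let $\nu_{\alpha_j}$ be the $(x-\alpha_j)$-adic valuation truncated at $\lambda_j$ (for vectors: the minimum over the entries). A vector of fractions $\boldsymbol f/g=(f_1/g,\dots,f_\ell/g)$, $g\neq0$, is reduced if $\gcd(f_1,\dots,f_\ell,g)=1$. Its multi-precision encoding is $\mathrm{Ev}^\infty(\boldsymbol f/g)=(\nu_{\alpha_j}(g),\mathcal S_j(\boldsymbol f/g))_{1\le j\le n}$, where $\mathcal S_j(\boldsymbol f/g)=\boldsymbol f/\bigl(g/(x-\alpha_j)^{\nu_{\alpha_j}(g)}\bigr)\bmod (x-\alpha_j)^{\lambda_j-\nu_{\alpha_j}(g)}$, with the convention $\mathcal S_j=\boldsymbol 1$ if $\nu_{\alpha_j}(g)=\lambda_j$. A received word is a sequence $\boldsymbol R=(\varrho_j,\boldsymbol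 r_j)_{1\le j\le n}$ with $0\le\varrho_j\le\lambda_j$ and $\boldsymbol r_j\in(\mathbb F_q[x]/(x-\alpha_j)^{\lambda_j})^\ell$ that is reduced, i.e. $\gcd(\boldsymbol r_j,(x-\alpha_j)^{\varrho_j})=1$ for all $j$; two such words are identified if $(x-\alpha_j)^{\varrho_j'}\boldsymbol r_j=(x-\alpha_j)^{\varrho_j}\boldsymbol r_j' \bmod (x-\alpha_j)^{\lambda_j}$ for all $j$. **Decoder** (distance parameter $t$). Let $S$ be the set of all $(\varphi,\psi_1,\dots,\psi_\ell)\in\mathbb F_q[x]^{\ell+1}$ with $\partial(\varphi)<d_g+t$, $\partial(\psi_i)<d_f+t$ and $(x-\alpha_j)^{\varrho_j}\psi_i=\varphi\, r_{i,j}\bmod (x-\alpha_j)^{\lambda_j}$ for all $i,j$. Choose a nonzero element of $S$ with $\max\{\partial(\varphi),\partial(\boldsymbol\psi)\}$ minimal, let $\eta=\gcd(\varphi,\psi_1,\dots,\psi_\ell)$, $\varphi'=\varphi/\eta$, $\boldsymbol\psi'=\boldsymbol\psi/\eta$. If $\partial(\eta)\le t$, $\varphi'\ne0$, $\partial(\varphi')<d_g$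 and $\partial(\boldsymbol\psi')<d_f$, return $\boldsymbol\psi'/\varphi'$; otherwise declare a decoding failure. **Error model.** Fix a reduced $\boldsymbol f/g$ with $\partial(\boldsymbol f)<d_f$, $\partial(g)<d_g$; disjoint sets $\xi_v,\xi_e\subseteq\{1,\dots,n\}$ of valuation and evaluation error positions; integers $\mu_j\ge 0$ with $\mu_j=\lambda_j$ for $j\notin\xi_e\cup\xi_v$, $\nu_{\alpha_j}(g)\le\mu_j<\lambda_j$ for $j\in\xi_e$, and $\mu_j\le\nu_{\alpha_j}(g)$, $\mu_j<\lambda_j$ for $j\in\xi_v$; and, for $j\in\xi_v$, fixed received symbols $\mathfrak R_j=(\varrho_j,\boldsymbol r_j)$ with $\varrho_j=\mu_j$ if $\mu_j<\nu_{\alpha_j}(g)$ and $\varrho_j>\nu_{\alpha_j}(g)$ if $\mu_j=\nu_{\alpha_j}(g)$. Let $\Lambda_v=\prod_{j\in\xi_v}(x-\alpha_j)^{\lambda_j-\mu_j}$ and $\Lambda_e=\prod_{j\in\xi_e}(x-\alpha_j)^{\lambda_j-\mu_j}$. Let $\mathcal B$ be the set of received words $\boldsymbol R$ with $\boldsymbol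 R_j=\mathrm{Ev}^\infty(\boldsymbol f/g)_j$ for $j\notin\xi_e\cup\xi_v$, $\boldsymbol R_j=\mathfrak R_j$ for $j\in\xi_v$, and $\boldsymbol R_j=(\nu_{\alpha_j}(g),\boldsymbol r_j)$ with $\nu_{\alpha_j}(\boldsymbol r_j-\mathcal S_j(\boldsymbol f/g))=\mu_j-\nu_{\alpha_j}(g)$ for $j\in\xi_e$. **Theorem.** Let $t_v,t_e\ge0$ be integers with $t_v\le\bigl\lfloor\frac{L-d_f-d_g+1}{2}\bigr\rfloor$ and $t_e\le\bar t_e:=\frac{\ell}{\ell+1}(L-d_f-d_g+1-2t_v)$, and suppose $\partial(\Lambda_v)\le t_v$ and $\partial(\Lambda_e)\le t_e$. If $\boldsymbol R$ is uniformly distributed in $\mathcal B$ (assumed non-empty), then the decoder with distance parameter $t=t_v+t_e$, whatever solution of minimal degree it chooses, outputs $\boldsymbol f/g$ except with probability at most $$q^{-(\ell+1)(\bar t_e-t_e)}\prod_{\alpha\in\mathcal Z(\Lambda_e)}\frac{1-q^{-(\ell+\nu_\alpha(\Lambda_e))}}{1-q^{-\ell}},$$ where $\mathcal Z(\Lambda_e)$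 is the set of roots of $\Lambda_e$ and $\nu_\alpha(\Lambda_e)$ the multiplicity of the root $\alpha$. -/

import Mathlib

open Polynomial

noncomputable section

namespace SRFPoles

open scoped Classical in
/-- Truncated valuation `ν_a(p) = min (Val_a p) m`: the largest `k ≤ m` with `(x - a)^k ∣ p`
(so the value is `m` for `p = 0`). -/
def polyVal {F : Type*} [Field F] (a : F) (m : ℕ) (p : F[X]) : ℕ :=
  Nat.findGreatest (fun k => (X - C a) ^ k ∣ p) m

/-- The ring `F[x] / (x - a)^m`. -/
abbrev Trunc {F : Type*} [Field F] (a : F) (m : ℕ) : Type _ :=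
  F[X] ⧸ Ideal.span {(X - C a) ^ m}

/-- The reduction `F[x] → F[x] / (x - a)^m`. -/
abbrev red {F : Type*} [Field F] (a : F) (m : ℕ) : F[X] →+* Trunc a m :=
  Ideal.Quotient.mk _

instance {F : Type*} [Field F] [Finite F] (a : F) (m : ℕ) : Finite (Trunc a m) := by
  have : Module.Finite F (Trunc a m) :=
    (((monic_X_sub_C a).pow m) : ((X - C a) ^ m).Monic).finite_quotient
  exact Module.finite_of_finite F

open scoped Classical in
/-- Truncated valuation of a vector over `F[x] / (x - a)^m`: the largest `k ≤ m` such that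
`(x - a)^k` divides all its entries. -/
def vecVal {F : Type*} [Field F] {a : F} {m ℓ : ℕ} (r : Fin ℓ → Trunc a m) : ℕ :=
  Nat.findGreatest (fun k => ∀ i, red a m ((X - C a) ^ k) ∣ r i) m

/-- Pairs `(ϱ, r)` in `[0, m] × (F[x] / (x - a)^m)^ℓ`. -/
abbrev Symb {F : Type*} [Field F] (a : F) (m ℓ : ℕ) : Type _ :=
  Fin (m + 1) × (Fin ℓ → Trunc a m)

/-- `(ϱ, r)` is reduced if `gcd (r, (x - a)^ϱ) = 1`, that is, if `ϱ = 0` or `x - a` does not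
divide all the entries of `r`. -/
def IsReducedSymb {F : Type*} [Field F] {a : F} {m ℓ : ℕ} (s : Symb a m ℓ) : Prop :=
  0 < (s.1 : ℕ) → ∃ i, ¬ red a m (X - C a) ∣ s.2 i

/-- The relation `(ϱ, r) ∼ (ϱ', r')` iff `(x - a)^ϱ' r = (x - a)^ϱ r' mod (x - a)^m`. -/
def SymbEquiv {F : Type*} [Field F] {a : F} {m ℓ : ℕ} (s s' : Symb a m ℓ) : Prop :=
  ∀ i, red a m ((X - C a) ^ (s'.1 : ℕ)) * s.2 i = red a m ((X - C a) ^ (s.1 : ℕ)) * s'.2 i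

/-- Reduced pairs. -/
abbrev RedSymb {F : Type*} [Field F] (a : F) (m ℓ : ℕ) : Type _ :=
  {s : Symb a m ℓ // IsReducedSymb s}

theorem red_dvd_iff {F : Type*} [Field F] {a : F} {m k : ℕ} (hk : k ≤ m) (p : F[X]) :
    red a m ((X - C a) ^ k) ∣ red a m p ↔ (X - C a) ^ k ∣ p := by
  constructor
  · rintro ⟨c, hc⟩
    obtain ⟨c, rfl⟩ := Ideal.Quotient.mk_surjective c
    rw [← map_mul, Ideal.Quotient.eq, Ideal.mem_span_singleton] at hc
    exact (dvd_sub_left (dvd_mul_right _ c)).mp ((pow_dvd_pow _ hk).trans hc)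
  · exact fun h => map_dvd _ h

/-- Equivalent reduced pairs have the same valuation part. -/
theorem val_le_of_symbEquiv {F : Type*} [Field F] {a : F} {m ℓ : ℕ} {s s' : Symb a m ℓ}
    (hs' : IsReducedSymb s') (h : SymbEquiv s s') : (s'.1 : ℕ) ≤ (s.1 : ℕ) := by
  by_contra! hlt
  obtain ⟨i, hi⟩ := hs' (by omega)
  apply hi
  have hm : (s'.1 : ℕ) ≤ m := Nat.lt_succ_iff.mp s'.1.2
  have h1 := h i
  obtain ⟨p', hp'⟩ := Ideal.Quotient.mk_surjective (s'.2 i)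
  obtain ⟨p, hp⟩ := Ideal.Quotient.mk_surjective (s.2 i)
  rw [← hp', ← hp, ← map_mul, ← map_mul] at h1
  have h2 : red a m ((X - C a) ^ ((s.1 : ℕ) + 1)) ∣ red a m ((X - C a) ^ (s.1 : ℕ) * p') := by
    rw [← h1]
    exact map_dvd _ ((pow_dvd_pow _ hlt).mul_right p)
  rw [red_dvd_iff (by omega), pow_succ,
    mul_dvd_mul_iff_left (pow_ne_zero _ (X_sub_C_ne_zero a))] at h2
  rw [← hp']
  exact map_dvd _ h2

/-- On reduced pairs `∼` is an equivalence relation. (It is not transitive on all pairs: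
`(m, 0)` is related to every pair.) -/
instance redSymbSetoid {F : Type*} [Field F] (a : F) (m ℓ : ℕ) : Setoid (RedSymb a m ℓ) where
  r s s' := SymbEquiv s.1 s'.1
  iseqv :=
    { refl := fun _ _ => rfl
      symm := fun h i => (h i).symm
      trans := by
        intro s s' s'' h h'
        have e1 : s.1.1 = s'.1.1 := Fin.ext (le_antisymm
          (val_le_of_symbEquiv s.2 (fun i => (h i).symm)) (val_le_of_symbEquiv s'.2 h))
        have e2 : s'.1.1 = s''.1.1 := Fin.ext (le_antisymm
          (val_le_of_symbEquiv s'.2 (fun i => (h' i).symm)) (val_le_of_symbEquiv s''.2 h'))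
        intro i
        have a1 := h i
        have a2 := h' i
        rw [e1] at a1 ⊢
        rw [← e2] at a2 ⊢
        exact a1.trans a2 }

/-- The set of received symbols at one evaluation point: reduced pairs modulo `∼`. -/
abbrev RecSymb {F : Type*} [Field F] (a : F) (m ℓ : ℕ) : Type _ :=
  Quotient (redSymbSetoid a m ℓ)

/-- The ambient space of received words. -/
abbrev Word {F : Type*} [Field F] {n : ℕ} (α : Fin n → F) (lam : Fin n → ℕ) (ℓ : ℕ) : Type _ :=
  ∀ j, RecSymb (α j) (lam j) ℓ

/-- The valuation part `ϱ` of a received symbol. -/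
def RecSymb.val {F : Type*} [Field F] {a : F} {m ℓ : ℕ} (s : RecSymb a m ℓ) : ℕ :=
  Quotient.lift (fun s : RedSymb a m ℓ => (s.1.1 : ℕ))
    (fun s s' h => le_antisymm (val_le_of_symbEquiv s.2 (fun i => (h i).symm))
      (val_le_of_symbEquiv s'.2 h)) s

/-- A reduced vector of fractions `f / g`, i.e. `g ≠ 0` and `gcd (f_1, …, f_ℓ, g) = 1`. -/
structure RedFrac (F : Type*) [Field F] (ℓ : ℕ) where
  num : Fin ℓ → F[X]
  den : F[X]
  den_ne_zero : den ≠ 0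
  coprime : ∀ d : F[X], d ∣ den → (∀ i, d ∣ num i) → IsUnit d

/-- The vector of rational functions `f / g`. -/
def RedFrac.toRat {F : Type*} [Field F] {ℓ : ℕ} (h : RedFrac F ℓ) (i : Fin ℓ) : RatFunc F :=
  algebraMap F[X] (RatFunc F) (h.num i) / algebraMap F[X] (RatFunc F) h.den

theorem polyVal_le {F : Type*} [Field F] (a : F) (m : ℕ) (p : F[X]) : polyVal a m p ≤ m := by
  classical exact Nat.findGreatest_le m

open scoped Classical in
/-- The reduction part `𝒮(f/g) = f / (g / (x - a)^v)` where `v = ν_a(g)`, equal to the vector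
`1` if `v = m`. It is meant modulo `(x - a)^(m - v)`; here it is lifted to precision `m`, where
`g / (x - a)^v` is invertible too, which does not change the class of `(v, 𝒮(f/g))`. -/
def evRed {F : Type*} [Field F] {ℓ : ℕ} (h : RedFrac F ℓ) (a : F) (m : ℕ) : Fin ℓ → Trunc a m :=
  fun i => if polyVal a m h.den = m then 1 else
    red a m (h.num i) * Ring.inverse (red a m (h.den / (X - C a) ^ polyVal a m h.den))

theorem evRed_isReduced {F : Type*} [Field F] {ℓ : ℕ} (h : RedFrac F ℓ) (a : F) (m : ℕ) :
    IsReducedSymb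
      ((⟨polyVal a m h.den, Nat.lt_succ_of_le (polyVal_le a m h.den)⟩, evRed h a m) :
        Symb a m ℓ) := by
  classical
  intro hpos
  change 0 < polyVal a m h.den at hpos
  have hvm := polyVal_le a m h.den
  have hdvd : (X - C a) ^ polyVal a m h.den ∣ h.den :=
    Nat.findGreatest_spec (P := fun k => (X - C a) ^ k ∣ h.den) (Nat.zero_le m) (by simp)
  have hx : X - C a ∣ h.den := (dvd_pow_self _ hpos.ne').trans hdvd
  have hex : ∃ i, ¬ (X - C a) ∣ h.num i := by
    by_contra! hc
    exact not_isUnit_X_sub_C a (h.coprime _ hx hc)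
  obtain ⟨i, hi⟩ := hex
  have key : ∀ p : F[X], red a m (X - C a) ∣ red a m p ↔ (X - C a) ∣ p := by
    intro p
    simpa using red_dvd_iff (a := a) (show 1 ≤ m by omega) p
  refine ⟨i, ?_⟩
  change ¬ red a m (X - C a) ∣ evRed h a m i
  unfold evRed
  split_ifs with hv
  · intro hc
    rw [← map_one (red a m), key] at hc
    exact not_isUnit_X_sub_C a (isUnit_of_dvd_one hc)
  · intro hc
    apply hi
    rw [← key]
    have hu : IsUnit (red a m (h.den / (X - C a) ^ polyVal a m h.den)) := by
      have hq : h.den = (X - C a) ^ polyVal a m h.den *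
          (h.den / (X - C a) ^ polyVal a m h.den) :=
        (EuclideanDomain.mul_div_cancel' (pow_ne_zero _ (X_sub_C_ne_zero a)) hdvd).symm
      have hn : ¬ (X - C a) ∣ h.den / (X - C a) ^ polyVal a m h.den := by
        rintro ⟨c, hc⟩
        have : (X - C a) ^ (polyVal a m h.den + 1) ∣ h.den := by
          refine ⟨c, ?_⟩
          rw [pow_succ, mul_assoc, ← hc]
          exact hq
        have := Nat.le_findGreatest (P := fun k => (X - C a) ^ k ∣ h.den)
          (show polyVal a m h.den + 1 ≤ m by omega) this
        change polyVal a m h.den + 1 ≤ polyVal a m h.den at this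
        omega
      have hcop : IsCoprime ((X - C a) ^ m) (h.den / (X - C a) ^ polyVal a m h.den) :=
        (((irreducible_X_sub_C a).coprime_iff_not_dvd).mpr hn).pow_left
      obtain ⟨u, w, huw⟩ := hcop
      refine IsUnit.of_mul_eq_one (red a m w) ?_
      rw [← map_mul, ← map_one (red a m), Ideal.Quotient.eq, Ideal.mem_span_singleton]
      exact ⟨-u, by linear_combination huw⟩
    have := hc.mul_right (red a m (h.den / (X - C a) ^ polyVal a m h.den))
    rwa [mul_assoc, Ring.inverse_mul_cancel _ hu, mul_one] at this

/-- The multi-precision encoding `Ev^∞(f/g)`: the symbols `(ν_{α_j}(g), 𝒮_j(f/g))`. -/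
def encode {F : Type*} [Field F] {n ℓ : ℕ} (α : Fin n → F) (lam : Fin n → ℕ)
    (h : RedFrac F ℓ) : Word α lam ℓ :=
  fun j => Quotient.mk _ ⟨_, evRed_isReduced h (α j) (lam j)⟩

/-! ### The decoder -/

/-- The solution set `S_R^∞` of the key equations with distance parameter `t`, for a word given
by reduced representatives. By the Chinese remainder theorem the key equations modulo
`M = ∏ (x - α_j)^{λ_j}` are the equations `(x - α_j)^{ϱ_j} ψ_i = φ r_{i,j}` modulo
`(x - α_j)^{λ_j}` for all `j`. -/
def solutions {F : Type*} [Field F] {n ℓ : ℕ} {α : Fin n → F} {lam : Fin n → ℕ}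
    (df dg t : ℕ) (R : ∀ j, RedSymb (α j) (lam j) ℓ) : Set (F[X] × (Fin ℓ → F[X])) :=
  {v | (∀ i j, red (α j) (lam j) ((X - C (α j)) ^ ((R j).1.1 : ℕ) * v.2 i) =
          red (α j) (lam j) v.1 * (R j).1.2 i) ∧
    v.1.degree < ((dg + t : ℕ) : WithBot ℕ) ∧
    ∀ i, (v.2 i).degree < ((df + t : ℕ) : WithBot ℕ)}

/-- `max {∂ φ, ∂ ψ}`. -/
def vecDeg {F : Type*} [Field F] {ℓ : ℕ} (v : F[X] × (Fin ℓ → F[X])) : WithBot ℕ :=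
  max v.1.degree (Finset.univ.sup fun i => (v.2 i).degree)

/-- `v` is a nonzero solution of minimal degree. -/
def IsMinSolution {F : Type*} [Field F] {n ℓ : ℕ} {α : Fin n → F} {lam : Fin n → ℕ}
    (df dg t : ℕ) (R : ∀ j, RedSymb (α j) (lam j) ℓ) (v : F[X] × (Fin ℓ → F[X])) : Prop :=
  v ∈ solutions df dg t R ∧ v ≠ 0 ∧
    ∀ w ∈ solutions df dg t R, w ≠ 0 → vecDeg v ≤ vecDeg w

/-- `η` is a greatest common divisor of `φ, ψ_1, …, ψ_ℓ`. -/
def IsVecGcd {F : Type*} [Field F] {ℓ : ℕ} (η : F[X]) (v : F[X] × (Fin ℓ → F[X])) : Prop :=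
  (η ∣ v.1 ∧ ∀ i, η ∣ v.2 i) ∧ ∀ d, d ∣ v.1 → (∀ i, d ∣ v.2 i) → d ∣ η

open scoped Classical in
/-- The last step of the decoder: with `φ' = φ / η`, `ψ' = ψ / η` return `ψ' / φ'` if
`∂ η ≤ t`, `∂ φ' < d_g` and `∂ ψ' < d_f`, and a decoding failure (`none`) otherwise. The case
`φ' = 0`, in which there is no fraction to return, counts as a failure. -/
def finalStep {F : Type*} [Field F] {ℓ : ℕ} (df dg t : ℕ) (v : F[X] × (Fin ℓ → F[X]))
    (η : F[X]) : Option (Fin ℓ → RatFunc F) :=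
  if η.degree ≤ (t : WithBot ℕ) ∧ v.1 / η ≠ 0 ∧ (v.1 / η).degree < (dg : WithBot ℕ) ∧
      ∀ i, (v.2 i / η).degree < (df : WithBot ℕ) then
    some fun i =>
      algebraMap F[X] (RatFunc F) (v.2 i / η) / algebraMap F[X] (RatFunc F) (v.1 / η)
  else none

/-- The possible outputs of the decoder, over all choices of a nonzero solution of minimal degree
(and of the unit in the gcd); if there is no nonzero solution the decoder fails. -/
def decoderOutputs {F : Type*} [Field F] {n ℓ : ℕ} {α : Fin n → F} {lam : Fin n → ℕ}
    (df dg t : ℕ) (R : ∀ j, RedSymb (α j) (lam j) ℓ) : Set (Option (Fin ℓ → RatFunc F)) :=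
  {o | ((∀ v, ¬ IsMinSolution df dg t R v) ∧ o = none) ∨
    ∃ v η, IsMinSolution df dg t R v ∧ IsVecGcd η v ∧ o = finalStep df dg t v η}

/-- Decoding of the received word `R` fails to output `f/g`: for some choice of reduced
representatives of `R` some run of the decoder has another output than `f/g`. -/
def DecodingFails {F : Type*} [Field F] {n ℓ : ℕ} {α : Fin n → F} {lam : Fin n → ℕ}
    (df dg t : ℕ) (h : RedFrac F ℓ) (R : Word α lam ℓ) : Prop :=
  ∃ R' : ∀ j, RedSymb (α j) (lam j) ℓ, (∀ j, (Quotient.mk _ (R' j) : RecSymb _ _ _) = R j) ∧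
    ∃ o ∈ decoderOutputs df dg t R', o ≠ some h.toRat

/-! ### The hybrid error model -/

/-- The parameters of the error model around `f/g`: disjoint supports `ξv`, `ξe` of valuation and
evaluation errors, error valuations `μ`, and the fixed received symbols `P j` for `j ∈ ξv` (the
other values of `P` play no role). -/
structure IsErrorPattern {F : Type*} [Field F] {n ℓ : ℕ} (α : Fin n → F) (lam : Fin n → ℕ)
    (h : RedFrac F ℓ) (ξv ξe : Finset (Fin n)) (μ : Fin n → ℕ) (P : Word α lam ℓ) : Prop where
  disjoint : Disjoint ξe ξv
  outside : ∀ j, j ∉ ξe ∪ ξv → μ j = lam j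
  evaluation : ∀ j ∈ ξe, polyVal (α j) (lam j) h.den ≤ μ j ∧ μ j < lam j
  valuation : ∀ j ∈ ξv, μ j ≤ polyVal (α j) (lam j) h.den ∧ μ j < lam j
  partial_lt : ∀ j ∈ ξv, μ j < polyVal (α j) (lam j) h.den → (P j).val = μ j
  partial_eq : ∀ j ∈ ξv, μ j = polyVal (α j) (lam j) h.den →
    polyVal (α j) (lam j) h.den < (P j).val

/-- The locator `∏_{j ∈ ξ} (x - α_j)^{λ_j - μ_j}`. -/
def locator {F : Type*} [Field F] {n : ℕ} (α : Fin n → F) (lam : Fin n → ℕ)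
    (ξ : Finset (Fin n)) (μ : Fin n → ℕ) : F[X] :=
  ∏ j ∈ ξ, (X - C (α j)) ^ (lam j - μ j)

/-- The set of received words of the error model: `R_j = Ev^∞(f/g)_j` outside the error supports,
`R_j = P_j` on `ξv`, and `R_j = (ν_{α_j}(g), r)` (a reduced pair) with
`ν_{α_j}(r - 𝒮_j(f/g)) = μ_j - ν_{α_j}(g)` on `ξe`. -/
def receivedSet {F : Type*} [Field F] {n ℓ : ℕ} (α : Fin n → F) (lam : Fin n → ℕ)
    (h : RedFrac F ℓ) (ξv ξe : Finset (Fin n)) (μ : Fin n → ℕ) (P : Word α lam ℓ) :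
    Set (Word α lam ℓ) :=
  {R | (∀ j, j ∉ ξe ∪ ξv → R j = encode α lam h j) ∧
    (∀ j ∈ ξv, R j = P j) ∧
    ∀ j ∈ ξe, ∃ s : RedSymb (α j) (lam j) ℓ, R j = Quotient.mk _ s ∧
      (s.1.1 : ℕ) = polyVal (α j) (lam j) h.den ∧
      vecVal (s.1.2 - evRed h (α j) (lam j)) = μ j - polyVal (α j) (lam j) h.den}

/-- Probability of the event `A` for a uniformly distributed element of the finite set `B`. -/
def uniformProb {T : Type*} [Finite T] (B : Set T) (A : T → Prop) : ℝ :=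
  ({x ∈ B | A x}.ncard : ℝ) / (B.ncard : ℝ)

/-- `t̄_e = ℓ / (ℓ + 1) * (L - d_f - d_g + 1 - 2 t_v)`. -/
def teBar (ℓ L df dg tv : ℕ) : ℝ :=
  (ℓ : ℝ) / ((ℓ : ℝ) + 1) * ((L : ℝ) - df - dg + 1 - 2 * tv)

end SRFPoles

end

/-!
A run of the decoder can only go wrong if some solution `(φ, ψ)` of the key equations is not
proportional to `(g, f)`: otherwise every solution is `p (g, f)` with a polynomial `p`, and
`Λ_v Λ_e (g, f)` is a solution, so that a solution of minimal degree has `deg p ≤ t`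
(`decoderOutputs_eq_toRat`). If `(φ, ψ)` is not proportional to `(g, f)`, then `φ f - ψ g ≠ 0` is
divisible by `∏ (x - α_j)^(μ_j)`, and the quotient `E` is a vector of polynomials of degree less than
`B = d_f + d_g + t - 1 - ∑ μ_j`. At an evaluation error, where the reduction part received is
`𝒮(f/g) + (x - α_j)^(μ_j - ν) u_j` with `ν` the valuation of `g` and `u_j` not divisible by
`x - α_j`, the key equation says that `E` is a multiple `c_j u_j` modulo
`(x - α_j)^(λ_j - μ_j)` (`hasSmallMultiple_of_decodingFails`).

It remains to bound the number of families `u` for which some multiple `c u`, with `c` in the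
product ring `∏ F[x] / (x - α_j)^(e_j)`, `e_j = λ_j - μ_j`, is the reduction of a nonzero vector of
degree less than `B`. For a fixed `c` of valuations `d_j` the vector must be a multiple of
`∏ (x - α_j)^(d_j)`, and each such vector comes from at most `q^(ℓ ∑ d_j)` families. This
gives at most `q^(ℓ B)` primitive families, with a factor `1 - q^(-ℓ)` to spare for each `j` with `c_j = 0`
(`card_small_multiple_le`). The sum over all `c` factors into `q^(ℓ B) ∏ (q^(e_j) - q^(-ℓ))`, and
dividing by the number `∏ q^(ℓ e_j) (1 - q^(-ℓ))` of primitive families gives the asserted product.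

The received words are not in bijection with all primitive families: where `g` vanishes at `α_j` and
`μ_j = ν`, the received symbol has to be reduced, so that `u_j(α_j)` must also avoid the negative of the
correct value. Each such restriction could raise the probability by a factor `(Q - 1) / (Q - 2)`,
`Q = q^ℓ`. One of them has no effect, because the linear group preserves the property of having
a small multiple and is transitive on the nonzero values at one point
(`card_hasSmallMultiple_avoiding`). There are at most `q - 1` restrictions, as `g` has too few zeros
for all `n ≤ q` points to be restricted (`card_restrictedPositions_lt`), and the remaining loss
`((Q - 1) / (Q - 2))^(q - 2) ≤ q - 1` is made up by the fact that each family with a small multiple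
is counted `q - 1` times, the multipliers being stable under `Fˣ`
(`card_hasSmallMultiple_mem_le`).
-/

noncomputable section

namespace SRFPoles

/-! ### Counting in truncations of `F[x]` at a point -/

/-- A polynomial representing a residue class. -/
def lift {F : Type*} [Field F] {a : F} {m : ℕ} (x : Trunc a m) : F[X] :=
  Quotient.out x

@[simp] theorem red_lift {F : Type*} [Field F] {a : F} {m : ℕ} (x : Trunc a m) :
    red a m (lift x) = x :=
  Ideal.Quotient.mk_out x

theorem red_eq_red_iff {F : Type*} [Field F] {a : F} {m : ℕ} {p q : F[X]} :
    red a m p = red a m q ↔ (X - C a) ^ m ∣ p - q := by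
  rw [Ideal.Quotient.eq, Ideal.mem_span_singleton]

theorem red_eq_zero_iff {F : Type*} [Field F] {a : F} {m : ℕ} {p : F[X]} :
    red a m p = 0 ↔ (X - C a) ^ m ∣ p := by
  rw [← map_zero (red a m), red_eq_red_iff, sub_zero]

/-- Multiplication by `(x - a)^k` is well defined from `F[x] / (x - a)^d` to `F[x] / (x - a)^m` when
`m ≤ k + d`. -/
theorem red_pow_mul_lift_red {F : Type*} [Field F] {a : F} {m k d : ℕ} (hm : m ≤ k + d)
    (p : F[X]) :
    red a m ((X - C a) ^ k * lift (red a d p)) = red a m ((X - C a) ^ k * p) := by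
  rw [red_eq_red_iff, ← mul_sub]
  have h : (X - C a) ^ d ∣ lift (red a d p) - p := red_eq_red_iff.mp (red_lift _)
  exact (pow_dvd_pow _ hm).trans (pow_add (X - C a) k d ▸ mul_dvd_mul_left _ h)

instance {F : Type*} [Field F] [Finite F] (a : F) (m : ℕ) : Fintype (Trunc a m) :=
  Fintype.ofFinite _

theorem card_trunc {F : Type*} [Field F] [Fintype F] (a : F) (m : ℕ) :
    Fintype.card (Trunc a m) = Fintype.card F ^ m := by
  have hfin : Module.Finite F (Trunc a m) :=
    (((monic_X_sub_C a).pow m) : ((X - C a) ^ m).Monic).finite_quotient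
  rw [Module.card_eq_pow_finrank (K := F), finrank_quotient_span_eq_natDegree]
  simp

theorem pow_polyVal_dvd {F : Type*} [Field F] (a : F) (m : ℕ) (p : F[X]) :
    (X - C a) ^ polyVal a m p ∣ p := by
  classical
  exact Nat.findGreatest_spec (P := fun k => (X - C a) ^ k ∣ p) (Nat.zero_le m) (by simp)

theorem le_polyVal {F : Type*} [Field F] {a : F} {m k : ℕ} {p : F[X]} (hk : k ≤ m)
    (h : (X - C a) ^ k ∣ p) : k ≤ polyVal a m p := by
  classical
  exact Nat.le_findGreatest (P := fun k => (X - C a) ^ k ∣ p) hk h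

/-- The cofactor of the truncated valuation is prime to `x - a` unless truncation occurs. -/
theorem not_dvd_of_eq_pow_polyVal_mul {F : Type*} [Field F] {a : F} {m : ℕ} {p p' : F[X]}
    (h : p = (X - C a) ^ polyVal a m p * p') (hlt : polyVal a m p < m) : ¬ (X - C a) ∣ p' := by
  rintro ⟨c, rfl⟩
  have : polyVal a m p + 1 ≤ polyVal a m p :=
    le_polyVal hlt ⟨c, by rw [pow_succ, mul_assoc]; exact h⟩
  omega

theorem polyVal_eq_iff_red_eq_zero {F : Type*} [Field F] {a : F} {m : ℕ} {p : F[X]} :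
    polyVal a m p = m ↔ red a m p = 0 := by
  rw [red_eq_zero_iff]
  constructor
  · intro h
    have := pow_polyVal_dvd a m p
    rwa [h] at this
  · intro h
    exact le_antisymm (polyVal_le _ _ _) (le_polyVal le_rfl h)

/-- A fibre of the multiplication by `p` on `F[x] / (x - a)^m` has at most as many elements as
the kernel, which consists of the multiples of `(x - a)^(m - v)`, where `v` is the valuation. -/
theorem card_fiber_mul_le {F : Type*} [Field F] [Fintype F] {a : F} {m : ℕ}
    (p : F[X]) (y : Trunc a m) [DecidablePred fun x : Trunc a m => red a m p * x = y] :
    (Finset.univ.filter fun x : Trunc a m => red a m p * x = y).card ≤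
      Fintype.card F ^ polyVal a m p := by
  classical
  set d := polyVal a m p with hd
  have hdm : d ≤ m := polyVal_le _ _ _
  obtain ⟨p', hp'⟩ := pow_polyVal_dvd a m p
  rcases (Finset.univ.filter fun x : Trunc a m => red a m p * x = y).eq_empty_or_nonempty with
    h0 | ⟨x₀, hx₀⟩
  · simp [h0]
  rw [Finset.mem_filter] at hx₀
  rw [← card_trunc a d, ← Finset.card_univ]
  refine Finset.card_le_card_of_surjOn
    (fun w : Trunc a d => x₀ + red a m ((X - C a) ^ (m - d) * lift w)) ?_
  intro x hx
  simp only [Finset.coe_filter, Finset.mem_univ, true_and, Set.mem_ofPred_eq] at hx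
  have h1 : (X - C a) ^ m ∣ p * (lift x - lift x₀) := by
    rw [← red_eq_zero_iff, map_mul, map_sub, red_lift, red_lift, mul_sub, hx, hx₀.2, sub_self]
  have h2 : (X - C a) ^ (m - d) ∣ lift x - lift x₀ := by
    rcases hdm.eq_or_lt with h | h
    · simp [h]
    · have hn := not_dvd_of_eq_pow_polyVal_mul hp' h
      have h3 : (X - C a) ^ d * (X - C a) ^ (m - d) ∣ (X - C a) ^ d * (p' * (lift x - lift x₀)) := by
        rw [← pow_add, Nat.add_sub_cancel' hdm, ← mul_assoc, hd, ← hp']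
        exact h1
      rw [mul_dvd_mul_iff_left (pow_ne_zero _ (X_sub_C_ne_zero a))] at h3
      exact (((irreducible_X_sub_C a).coprime_iff_not_dvd.mpr hn).pow_left).dvd_of_dvd_mul_left h3
  obtain ⟨w, hw⟩ := h2
  refine ⟨red a d w, Finset.mem_coe.mpr (Finset.mem_univ _), ?_⟩
  change x₀ + red a m _ = x
  rw [red_pow_mul_lift_red (by omega), ← hw, map_sub, red_lift, red_lift]
  ring

/-- Evaluation at `a` on `F[x] / (x - a)^m`, `m > 0`. -/
def evalAt {F : Type*} [Field F] {a : F} {m : ℕ} (hm : 0 < m) : Trunc a m →+* F :=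
  Ideal.Quotient.lift _ (evalRingHom a) (by
    intro p hp
    rw [Ideal.mem_span_singleton] at hp
    obtain ⟨c, rfl⟩ := hp
    simp [hm.ne'])

@[simp] theorem evalAt_red {F : Type*} [Field F] {a : F} {m : ℕ} (hm : 0 < m) (p : F[X]) :
    evalAt hm (red a m p) = p.eval a := rfl

theorem dvd_iff_evalAt {F : Type*} [Field F] {a : F} {m : ℕ} (hm : 0 < m) (x : Trunc a m) :
    red a m (X - C a) ∣ x ↔ evalAt hm x = 0 := by
  obtain ⟨p, rfl⟩ := Ideal.Quotient.mk_surjective x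
  have h := red_dvd_iff (a := a) (show 1 ≤ m from hm) p
  rw [pow_one] at h
  rw [h, dvd_iff_isRoot]
  rfl

/-- Componentwise evaluation is surjective and its fibres all have the same size. -/
theorem card_filter_evalAt {F : Type*} [Field F] [Fintype F] {a : F} {m ℓ : ℕ}
    (hm : 0 < m) (S : Finset (Fin ℓ → F))
    [DecidablePred fun u : Fin ℓ → Trunc a m => (fun i => evalAt hm (u i)) ∈ S] :
    (Finset.univ.filter fun u : Fin ℓ → Trunc a m => (fun i => evalAt hm (u i)) ∈ S).card *
      Fintype.card F ^ ℓ = S.card * Fintype.card F ^ (m * ℓ) := by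
  classical
  let ev : (Fin ℓ → Trunc a m) →+ (Fin ℓ → F) :=
    { toFun := fun u i => evalAt hm (u i)
      map_zero' := by ext; simp
      map_add' := by intros; ext; simp }
  have hsurj : Function.Surjective ev := fun y => ⟨fun i => red a m (C (y i)), by ext; simp [ev]⟩
  have hfib : ∀ y, (Finset.univ.filter fun u => ev u = y).card = Nat.card ev.ker := by
    intro y
    rw [← Nat.card_congr (AddMonoidHom.fiberEquivKerOfSurjective hsurj y),
      Nat.card_eq_fintype_card, Fintype.card_subtype]
    congr 1
    ext u
    simp
  have hS : ∀ S : Finset (Fin ℓ → F),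
      (Finset.univ.filter fun u => ev u ∈ S).card = S.card * Nat.card ev.ker := by
    intro S
    rw [Finset.card_eq_sum_card_fiberwise (f := ev) (t := S)]
    · rw [Finset.sum_congr rfl (g := fun _ => Nat.card ev.ker), Finset.sum_const, smul_eq_mul]
      intro y hy
      rw [← hfib y, Finset.filter_filter]
      congr 1
      ext u
      simp only [Finset.mem_filter, Finset.mem_univ, true_and]
      exact ⟨fun h => h.2, fun h => ⟨h ▸ hy, h⟩⟩
    · intro u hu
      simpa using hu
  have huniv := hS Finset.univ
  have hc : (Finset.univ : Finset (Fin ℓ → F)).card = Fintype.card F ^ ℓ := by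
    simp
  have hc' : (Finset.univ.filter fun u => ev u ∈ (Finset.univ : Finset (Fin ℓ → F))).card =
      Fintype.card F ^ (m * ℓ) := by
    simp [card_trunc, pow_mul]
  rw [hc, hc'] at huniv
  have h := hS S
  rw [huniv, mul_left_comm, ← h, mul_comm]
  congr 2
  ext u
  simp only [Finset.mem_filter, Finset.mem_univ, true_and]
  rfl

/-- Vectors whose entries are not all divisible by `x - a`: their number. -/
theorem card_primitive {F : Type*} [Field F] [Fintype F] {a : F} {m ℓ : ℕ} (hm : 0 < m)
    [DecidablePred fun u : Fin ℓ → Trunc a m => (fun i => evalAt hm (u i)) ≠ 0] :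
    ((Finset.univ.filter fun u : Fin ℓ → Trunc a m => (fun i => evalAt hm (u i)) ≠ 0).card : ℝ) =
      (Fintype.card F : ℝ) ^ (m * ℓ) * (1 - 1 / (Fintype.card F : ℝ) ^ ℓ) := by
  classical
  have h := card_filter_evalAt (a := a) (m := m) (ℓ := ℓ) hm (Finset.univ.erase 0)
  have hc : (Finset.univ.erase (0 : Fin ℓ → F)).card = Fintype.card F ^ ℓ - 1 := by
    rw [Finset.card_erase_of_mem (Finset.mem_univ _)]; simp
  simp only [Finset.mem_erase, Finset.mem_univ, and_true] at h
  have hq : 0 < Fintype.card F := Fintype.card_pos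
  have hq1 : 1 ≤ Fintype.card F ^ ℓ := Nat.one_le_pow _ _ hq
  rw [hc] at h
  have h' := congrArg (Nat.cast : ℕ → ℝ) h
  push_cast [Nat.cast_sub hq1] at h'
  have hq0 : (Fintype.card F : ℝ) ^ ℓ ≠ 0 := by positivity
  have e : ∀ x y z : ℝ, z ≠ 0 → x * z = (z - 1) * y → x = y * (1 - 1 / z) := by
    intro x y z hz hxy
    field_simp
    linarith
  convert e _ _ _ hq0 h' using 3

/-- The number of primitive vectors `u` with `p u = y`: it is at most the size of the kernel of
the multiplication by `p`, and if `p = 0` there are no further vectors than the primitive ones. -/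
theorem card_primitive_fiber_le {F : Type*} [Field F] [Fintype F] {a : F} {m ℓ : ℕ} (hm : 0 < m)
    (p : F[X]) (y : Fin ℓ → Trunc a m)
    [DecidablePred fun u : Fin ℓ → Trunc a m =>
      (fun i => evalAt hm (u i)) ≠ 0 ∧ ∀ i, red a m p * u i = y i]
    [Decidable (red a m p = 0)] :
    ((Finset.univ.filter fun u : Fin ℓ → Trunc a m =>
      (fun i => evalAt hm (u i)) ≠ 0 ∧ ∀ i, red a m p * u i = y i).card : ℝ) ≤
      (Fintype.card F : ℝ) ^ (polyVal a m p * ℓ) *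
        if red a m p = 0 then 1 - 1 / (Fintype.card F : ℝ) ^ ℓ else 1 := by
  classical
  split_ifs with h
  · rw [polyVal_eq_iff_red_eq_zero.mpr h, ← card_primitive (a := a) hm]
    refine Nat.cast_le.mpr (Finset.card_le_card fun u hu => ?_)
    exact Finset.mem_filter.mpr ⟨Finset.mem_univ _, (Finset.mem_filter.mp hu).2.1⟩
  · rw [mul_one, pow_mul]
    have : (Finset.univ.filter fun u : Fin ℓ → Trunc a m =>
      (fun i => evalAt hm (u i)) ≠ 0 ∧ ∀ i, red a m p * u i = y i) ⊆
        Fintype.piFinset fun i => Finset.univ.filter fun x : Trunc a m => red a m p * x = y i := by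
      intro u hu
      simpa using (Finset.mem_filter.mp hu).2.2
    have h2 := (Finset.card_le_card this).trans_eq (Fintype.card_piFinset _)
    have h3 : ∏ i : Fin ℓ, (Finset.univ.filter fun x : Trunc a m => red a m p * x = y i).card ≤
        ∏ i : Fin ℓ, Fintype.card F ^ polyVal a m p :=
      Finset.prod_le_prod' fun i _ => card_fiber_mul_le p (y i)
    rw [Finset.prod_const, Finset.card_univ, Fintype.card_fin] at h3
    exact_mod_cast h2.trans h3

/-! ### Small multiples of a family of vectors -/

/-- For a family of vectors `u_j` over `F[x] / (x - a_j)^(e_j)`: some multiple `c u` is the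
reduction of a nonzero vector of polynomials of degree less than `B`. The multiplier `c` is an
arbitrary element of the product ring. -/
def HasSmallMultiple {F : Type*} [Field F] {J : Type*} {ℓ : ℕ} {a : J → F} {e : J → ℕ} (B : ℕ)
    (u : ∀ j, Fin ℓ → Trunc (a j) (e j)) : Prop :=
  ∃ c : ∀ j, Trunc (a j) (e j), ∃ E : Fin ℓ → F[X], E ≠ 0 ∧
    (∀ i, (E i).degree < (B : WithBot ℕ)) ∧ ∀ j i, c j * u j i = red (a j) (e j) (E i)

/-- The linear group acts transitively on nonzero vectors. -/
theorem exists_matrix_mulVec_eq {F : Type*} [Field F] {ℓ : ℕ} {y z : Fin ℓ → F} (hy : y ≠ 0)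
    (hz : z ≠ 0) :
    ∃ A A' : Matrix (Fin ℓ) (Fin ℓ) F, A' * A = 1 ∧ A.mulVec y = z := by
  let f := (LinearEquiv.toSpanNonzeroSingleton F _ y hy).symm ≪≫ₗ
    LinearEquiv.toSpanNonzeroSingleton F _ z hz
  obtain ⟨g, hg⟩ := Submodule.exists_linearEquiv_restrict_eq f
  refine ⟨LinearMap.toMatrix' g.toLinearMap, LinearMap.toMatrix' g.symm.toLinearMap, ?_, ?_⟩
  · rw [← LinearMap.toMatrix'_comp]
    simp
  · rw [LinearMap.toMatrix'_mulVec]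
    have h := hg ⟨y, Submodule.mem_span_singleton_self y⟩
    change _ = g y at h
    change g y = z
    rw [← h]
    have e1 : (⟨y, Submodule.mem_span_singleton_self y⟩ : Submodule.span F {y}) =
        LinearEquiv.toSpanNonzeroSingleton F _ y hy 1 := by
      ext; simp
    rw [e1, LinearEquiv.trans_apply, LinearEquiv.symm_apply_apply]
    simp

theorem HasSmallMultiple.mulVec {F : Type*} [Field F] {J : Type*} {ℓ B : ℕ} {a : J → F}
    {e : J → ℕ} {u : ∀ j, Fin ℓ → Trunc (a j) (e j)} (hu : HasSmallMultiple B u)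
    {A A' : Matrix (Fin ℓ) (Fin ℓ) F} (hA : A' * A = 1) :
    HasSmallMultiple B fun j => (A.map ((red (a j) (e j)).comp C)).mulVec (u j) := by
  obtain ⟨c, E, hE, hdeg, hc⟩ := hu
  refine ⟨c, (A.map C).mulVec E, ?_, ?_, ?_⟩
  · intro h
    apply hE
    have h1 : (A'.map C).mulVec ((A.map C).mulVec E) = E := by
      rw [Matrix.mulVec_mulVec, ← Matrix.map_mul, hA]
      simp
    rw [← h1, h, Matrix.mulVec_zero]
  · intro i
    rw [← mem_degreeLT]
    change ∑ k, A.map C i k * E k ∈ degreeLT F B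
    refine Submodule.sum_mem _ fun k _ => ?_
    rw [Matrix.map_apply, ← smul_eq_C_mul]
    exact Submodule.smul_mem _ _ (mem_degreeLT.mpr (hdeg k))
  · intro j i
    have h := congrFun (Matrix.mulVec_smul (A.map ((red (a j) (e j)).comp C)) (c j) (u j)) i
    have h2 : c j • u j = fun i => red (a j) (e j) (E i) := by
      ext i; exact hc j i
    rw [h2] at h
    change _ = c j * _ at h
    rw [← h, RingHom.map_mulVec]
    rfl

/-- A polynomial divisible by `(x - a_j)^(k_j)` for all `j` is divisible by the product. -/
theorem prod_pow_dvd {F : Type*} [Field F] {J : Type*} [Fintype J] {a : J → F}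
    (ha : Function.Injective a) {k : J → ℕ} {p : F[X]}
    (h : ∀ j, (X - C (a j)) ^ k j ∣ p) : ∏ j, (X - C (a j)) ^ k j ∣ p :=
  Finset.prod_dvd_of_coprime
    (fun _ _ _ _ hij => (pairwise_coprime_X_sub_C ha hij).pow) fun j _ => h j

theorem degree_prod_pow {F : Type*} [Field F] {J : Type*} [Fintype J] (a : J → F) (k : J → ℕ) :
    (∏ j, (X - C (a j)) ^ k j).degree = ((∑ j, k j : ℕ) : WithBot ℕ) := by
  simp [degree_prod]

theorem prod_pow_ne_zero {F : Type*} [Field F] {J : Type*} [Fintype J] (a : J → F) (k : J → ℕ) :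
    ∏ j, (X - C (a j)) ^ k j ≠ 0 :=
  Finset.prod_ne_zero_iff.mpr fun _ _ => pow_ne_zero _ (X_sub_C_ne_zero _)

section Count

variable {F : Type*} [Field F] [Fintype F] {J : Type*} [Fintype J] {ℓ : ℕ} {a : J → F}
  {e : J → ℕ}

open scoped Classical in
/-- The number of primitive families `u` for which a fixed multiplier `c` gives a small vector. -/
theorem card_small_multiple_le (ha : Function.Injective a) (he : ∀ j, 0 < e j) (B : ℕ)
    (c : ∀ j, Trunc (a j) (e j)) :
    ((Finset.univ.filter fun u : ∀ j, Fin ℓ → Trunc (a j) (e j) =>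
        (∀ j, (fun i => evalAt (he j) (u j i)) ≠ 0) ∧
        ∃ E : Fin ℓ → F[X], E ≠ 0 ∧ (∀ i, (E i).degree < (B : WithBot ℕ)) ∧
          ∀ j i, c j * u j i = red (a j) (e j) (E i)).card : ℝ) ≤
      (Fintype.card F : ℝ) ^ (B * ℓ) *
        ∏ j, if c j = 0 then 1 - 1 / (Fintype.card F : ℝ) ^ ℓ else 1 := by
  have hq : (1 : ℝ) ≤ Fintype.card F := by exact_mod_cast Fintype.card_pos
  have hw : ∀ j, (0 : ℝ) ≤ if c j = 0 then 1 - 1 / (Fintype.card F : ℝ) ^ ℓ else 1 := by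
    intro j
    split_ifs
    · rw [sub_nonneg, div_le_one (by positivity)]
      exact one_le_pow₀ hq
    · exact zero_le_one
  set d : J → ℕ := fun j => polyVal (a j) (e j) (lift (c j)) with hd
  set D : F[X] := ∏ j, (X - C (a j)) ^ d j with hD
  have hD0 : D ≠ 0 := prod_pow_ne_zero a d
  have hdvd : ∀ (u : ∀ j, Fin ℓ → Trunc (a j) (e j)) (E : Fin ℓ → F[X]),
      (∀ j i, c j * u j i = red (a j) (e j) (E i)) → ∀ i, D ∣ E i := by
    intro u E h i
    refine prod_pow_dvd ha fun j => ?_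
    rw [← red_dvd_iff (polyVal_le _ _ _), ← h j i]
    refine Dvd.dvd.mul_right ?_ _
    conv_rhs => rw [← red_lift (c j)]
    exact map_dvd _ (pow_polyVal_dvd _ _ _)
  rcases Nat.lt_or_ge (∑ j, d j) B with hB | hB
  · set k := B - ∑ j, d j with hk
    let G : (Fin ℓ → Fin k → F) → Finset (∀ j, Fin ℓ → Trunc (a j) (e j)) := fun w =>
      Fintype.piFinset fun j => Finset.univ.filter fun v : Fin ℓ → Trunc (a j) (e j) =>
        (fun i => evalAt (he j) (v i)) ≠ 0 ∧ ∀ i, red (a j) (e j) (lift (c j)) * v i =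
          red (a j) (e j) (D * ((degreeLTEquiv F k).symm (w i) : F[X]))
    have hG : ∀ w, ((G w).card : ℝ) ≤ ∏ j, ((Fintype.card F : ℝ) ^ (d j * ℓ) *
        if c j = 0 then 1 - 1 / (Fintype.card F : ℝ) ^ ℓ else 1) := by
      intro w
      rw [Fintype.card_piFinset, Nat.cast_prod]
      refine Finset.prod_le_prod (fun _ _ => Nat.cast_nonneg _) fun j _ => ?_
      have := card_primitive_fiber_le (he j) (lift (c j))
        (fun i => red (a j) (e j) (D * ((degreeLTEquiv F k).symm (w i) : F[X])))
      simp only [red_lift] at this ⊢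
      exact this
    have hsub : (Finset.univ.filter fun u : ∀ j, Fin ℓ → Trunc (a j) (e j) =>
        (∀ j, (fun i => evalAt (he j) (u j i)) ≠ 0) ∧
        ∃ E : Fin ℓ → F[X], E ≠ 0 ∧ (∀ i, (E i).degree < (B : WithBot ℕ)) ∧
          ∀ j i, c j * u j i = red (a j) (e j) (E i)) ⊆ Finset.univ.biUnion G := by
      intro u hu
      obtain ⟨hu0, E, -, hdeg, hE⟩ := (Finset.mem_filter.mp hu).2
      choose w hw using hdvd u E hE
      have hwdeg : ∀ i, w i ∈ degreeLT F k := by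
        intro i
        rw [mem_degreeLT]
        rcases eq_or_ne (w i) 0 with h0 | h0
        · rw [h0, degree_zero]; exact WithBot.bot_lt_coe _
        have := hdeg i
        rw [hw i, degree_mul, hD, degree_prod_pow, degree_eq_natDegree h0] at this
        rw [degree_eq_natDegree h0]
        norm_cast at this ⊢
        omega
      refine Finset.mem_biUnion.mpr ⟨fun i => degreeLTEquiv F k ⟨w i, hwdeg i⟩,
        Finset.mem_univ _, ?_⟩
      refine Fintype.mem_piFinset.mpr fun j => Finset.mem_filter.mpr
        ⟨Finset.mem_univ _, hu0 j, fun i => ?_⟩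
      rw [red_lift, LinearEquiv.symm_apply_apply, hE j i, hw i]
    have h1 := (Finset.card_le_card hsub).trans Finset.card_biUnion_le
    have h2 : (∑ w, ((G w).card : ℝ)) ≤ ∑ _w : Fin ℓ → Fin k → F, ∏ j,
        ((Fintype.card F : ℝ) ^ (d j * ℓ) *
        if c j = 0 then 1 - 1 / (Fintype.card F : ℝ) ^ ℓ else 1) :=
      Finset.sum_le_sum fun w _ => hG w
    refine (Nat.cast_le.mpr h1).trans ?_
    rw [Nat.cast_sum]
    refine h2.trans_eq ?_
    rw [Finset.sum_const, Finset.card_univ, nsmul_eq_mul, Finset.prod_mul_distrib, ← mul_assoc]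
    congr 1
    rw [Finset.prod_pow_eq_pow_sum, ← Finset.sum_mul]
    simp only [Fintype.card_pi, Finset.prod_const, Finset.card_univ, Fintype.card_fin]
    push_cast
    rw [← pow_mul, ← pow_add, ← add_mul, hk, Nat.sub_add_cancel hB.le]
  · rw [Finset.filter_false_of_mem]
    · have := Finset.prod_nonneg fun j (_ : j ∈ Finset.univ) => hw j
      simp only [Finset.card_empty, Nat.cast_zero]
      positivity
    · rintro u - ⟨-, E, hE0, hdeg, hE⟩
      refine hE0 (funext fun i => ?_)
      by_contra hi
      have h1 := degree_le_of_dvd (hdvd u E hE i) hi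
      rw [hD, degree_prod_pow] at h1
      have h2 := h1.trans_lt (hdeg i)
      norm_cast at h2
      omega

open scoped Classical in
/-- Union bound over the multipliers. Since multipliers can be scaled by `Fˣ`, every family with
a small multiple is counted at least `|F| - 1` times. -/
theorem card_hasSmallMultiple_le (ha : Function.Injective a) (he : ∀ j, 0 < e j) {B : ℕ}
    (hB : B ≤ ∑ j, e j) :
    ((Fintype.card F : ℝ) - 1) *
      ((Finset.univ.filter fun u : ∀ j, Fin ℓ → Trunc (a j) (e j) =>
        (∀ j, (fun i => evalAt (he j) (u j i)) ≠ 0) ∧ HasSmallMultiple B u).card : ℝ) ≤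
      (Fintype.card F : ℝ) ^ (B * ℓ) *
        ∏ j, ((Fintype.card F : ℝ) ^ e j - 1 / (Fintype.card F : ℝ) ^ ℓ) := by
  set S := Finset.univ.filter fun u : ∀ j, Fin ℓ → Trunc (a j) (e j) =>
        (∀ j, (fun i => evalAt (he j) (u j i)) ≠ 0) ∧ HasSmallMultiple B u with hS
  let r : (∀ j, Fin ℓ → Trunc (a j) (e j)) → (∀ j, Trunc (a j) (e j)) → Prop := fun u c =>
    ∃ E : Fin ℓ → F[X], E ≠ 0 ∧ (∀ i, (E i).degree < (B : WithBot ℕ)) ∧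
          ∀ j i, c j * u j i = red (a j) (e j) (E i)
  have hmany : ∀ u ∈ S, Fintype.card Fˣ ≤ (Finset.univ.filter fun c => r u c).card := by
    intro u hu
    obtain ⟨c, E, hE0, hdeg, hE⟩ := (Finset.mem_filter.mp hu).2.2
    have hc : ∃ j, c j ≠ 0 := by
      by_contra! hc
      refine hE0 (funext fun i => ?_)
      by_contra hi
      have h1 : ∏ j, (X - C (a j)) ^ e j ∣ E i := by
        refine prod_pow_dvd ha fun j => ?_
        rw [← red_eq_zero_iff, ← hE j i, hc j, zero_mul]
      have h2 := degree_le_of_dvd h1 hi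
      rw [degree_prod_pow] at h2
      have h3 := h2.trans_lt (hdeg i)
      norm_cast at h3
      omega
    obtain ⟨j₀, hj₀⟩ := hc
    rw [← Finset.card_univ]
    refine Finset.card_le_card_of_injOn
      (fun (t : Fˣ) j => red (a j) (e j) (C (t : F)) * c j) ?_ ?_
    · intro t _
      refine Finset.mem_coe.mpr (Finset.mem_filter.mpr ⟨Finset.mem_univ _,
        fun i => C (t : F) * E i, ?_, ?_, ?_⟩)
      · intro h
        refine hE0 (funext fun i => ?_)
        have := congrFun h i
        simpa using this
      · intro i
        rw [degree_C_mul t.ne_zero]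
        exact hdeg i
      · intro j i
        rw [mul_assoc, hE j i, map_mul]
    · intro s _ t _ hst
      by_contra hne
      have h1 := congrFun hst j₀
      have h2 : red (a j₀) (e j₀) (C ((s : F) - t)) * c j₀ = 0 := by
        rw [C_sub, map_sub, sub_mul]
        exact sub_eq_zero.mpr h1
      have h3 : IsUnit (red (a j₀) (e j₀) (C ((s : F) - t))) :=
        ((isUnit_iff_ne_zero.mpr (sub_ne_zero.mpr (Units.val_injective.ne hne))).map C).map _
      exact hj₀ (h3.mul_right_eq_zero.mp h2)
  have hcount := Finset.sum_card_bipartiteAbove_eq_sum_card_bipartiteBelow (s := S)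
    (t := Finset.univ) r
  have hlow : Fintype.card Fˣ * S.card ≤
      ∑ u ∈ S, (Finset.univ.filter fun c => r u c).card := by
    rw [mul_comm, ← smul_eq_mul]
    exact Finset.card_nsmul_le_sum _ _ _ hmany
  have hhigh : ∀ c : (∀ j, Trunc (a j) (e j)), ((S.filter fun u => r u c).card : ℝ) ≤
      (Fintype.card F : ℝ) ^ (B * ℓ) *
        ∏ j, if c j = 0 then 1 - 1 / (Fintype.card F : ℝ) ^ ℓ else 1 := by
    intro c
    refine le_trans (Nat.cast_le.mpr (Finset.card_le_card ?_))
      (card_small_multiple_le (ℓ := ℓ) ha he B c)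
    intro u hu
    obtain ⟨h1, h2⟩ := Finset.mem_filter.mp hu
    exact Finset.mem_filter.mpr ⟨Finset.mem_univ _, (Finset.mem_filter.mp h1).2.1, h2⟩
  have hsum : ∀ j, ∑ x : Trunc (a j) (e j),
      (if x = 0 then 1 - 1 / (Fintype.card F : ℝ) ^ ℓ else 1) =
      (Fintype.card F : ℝ) ^ e j - 1 / (Fintype.card F : ℝ) ^ ℓ := by
    intro j
    have : ∀ x : Trunc (a j) (e j), (if x = 0 then 1 - 1 / (Fintype.card F : ℝ) ^ ℓ else 1) =
        1 - if x = 0 then 1 / (Fintype.card F : ℝ) ^ ℓ else 0 := by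
      intro x; split_ifs <;> simp
    simp_rw [this]
    rw [Finset.sum_sub_distrib]
    simp [card_trunc]
  have hqu : ((Fintype.card Fˣ : ℕ) : ℝ) = (Fintype.card F : ℝ) - 1 := by
    rw [Fintype.card_eq_card_units_add_one (α := F)]
    simp
  calc ((Fintype.card F : ℝ) - 1) * (S.card : ℝ)
      = ((Fintype.card Fˣ * S.card : ℕ) : ℝ) := by rw [Nat.cast_mul, hqu]
    _ ≤ ((∑ c, (S.filter fun u => r u c).card : ℕ) : ℝ) := by
        refine Nat.cast_le.mpr (hlow.trans_eq ?_)
        exact hcount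
    _ ≤ ∑ c : (∀ j, Trunc (a j) (e j)), (Fintype.card F : ℝ) ^ (B * ℓ) *
        ∏ j, (if c j = 0 then 1 - 1 / (Fintype.card F : ℝ) ^ ℓ else 1) := by
        rw [Nat.cast_sum]
        exact Finset.sum_le_sum fun c _ => hhigh c
    _ = _ := by
        rw [← Finset.mul_sum]
        congr 1
        simp_rw [← hsum]
        rw [Finset.prod_univ_sum, Fintype.piFinset_univ]

open scoped Classical in
/-- By symmetry under the linear group, the families with a small multiple are equidistributed
with respect to the value `u_j(a_j)` at one position. -/
theorem card_hasSmallMultiple_fiber_le (he : ∀ j, 0 < e j) (B : ℕ)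
    (j₀ : J) {y z : Fin ℓ → F} (hy : y ≠ 0) (hz : z ≠ 0) :
    (Finset.univ.filter fun u : ∀ j, Fin ℓ → Trunc (a j) (e j) =>
        ((∀ j, (fun i => evalAt (he j) (u j i)) ≠ 0) ∧ HasSmallMultiple B u) ∧
          (fun i => evalAt (he j₀) (u j₀ i)) = y).card ≤
    (Finset.univ.filter fun u : ∀ j, Fin ℓ → Trunc (a j) (e j) =>
        ((∀ j, (fun i => evalAt (he j) (u j i)) ≠ 0) ∧ HasSmallMultiple B u) ∧
          (fun i => evalAt (he j₀) (u j₀ i)) = z).card := by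
  obtain ⟨A, A', hA, hAy⟩ := exists_matrix_mulVec_eq hy hz
  have hev : ∀ j (v : Fin ℓ → Trunc (a j) (e j)),
      (fun i => evalAt (he j) ((A.map ((red (a j) (e j)).comp C)).mulVec v i)) =
        A.mulVec fun i => evalAt (he j) (v i) := by
    intro j v
    ext i
    rw [RingHom.map_mulVec]
    congr 1
    ext k l
    simp
  have hinv : ∀ y : Fin ℓ → F, A'.mulVec (A.mulVec y) = y := by
    intro y
    rw [Matrix.mulVec_mulVec, hA, Matrix.one_mulVec]
  refine Finset.card_le_card_of_injOn
    (fun u j => (A.map ((red (a j) (e j)).comp C)).mulVec (u j)) ?_ ?_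
  · intro u hu
    obtain ⟨⟨h1, h2⟩, h3⟩ := (Finset.mem_filter.mp (Finset.mem_coe.mp hu)).2
    refine Finset.mem_coe.mpr (Finset.mem_filter.mpr ⟨Finset.mem_univ _,
      ⟨fun j => ?_, h2.mulVec hA⟩, ?_⟩)
    · rw [hev]
      intro h
      apply h1 j
      rw [← hinv (fun i => evalAt (he j) (u j i)), h, Matrix.mulVec_zero]
    · rw [hev, h3, hAy]
  · intro u _ v _ huv
    funext j
    have h := congrArg (A'.map ((red (a j) (e j)).comp C)).mulVec (congrFun huv j)
    have h' : ∀ w : Fin ℓ → Trunc (a j) (e j), (A'.map ((red (a j) (e j)).comp C)).mulVec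
        ((A.map ((red (a j) (e j)).comp C)).mulVec w) = w := by
      intro w
      rw [Matrix.mulVec_mulVec, ← Matrix.map_mul, hA]
      simp
    simpa only [h'] using h

open scoped Classical in
/-- Excluding one nonzero value of `u_j(a_j)` keeps exactly the fraction
`(|F|^ℓ - 2) / (|F|^ℓ - 1)` of the families with a small multiple. -/
theorem card_hasSmallMultiple_avoiding (he : ∀ j, 0 < e j) (B : ℕ)
    (j₀ : J) {y : Fin ℓ → F} (hy : y ≠ 0) :
    ((Fintype.card F : ℝ) ^ ℓ - 1) *
      ((Finset.univ.filter fun u : ∀ j, Fin ℓ → Trunc (a j) (e j) =>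
        ((∀ j, (fun i => evalAt (he j) (u j i)) ≠ 0) ∧ HasSmallMultiple B u) ∧
          (fun i => evalAt (he j₀) (u j₀ i)) ≠ y).card : ℝ) =
    ((Fintype.card F : ℝ) ^ ℓ - 2) *
      ((Finset.univ.filter fun u : ∀ j, Fin ℓ → Trunc (a j) (e j) =>
        (∀ j, (fun i => evalAt (he j) (u j i)) ≠ 0) ∧ HasSmallMultiple B u).card : ℝ) := by
  set S := Finset.univ.filter fun u : ∀ j, Fin ℓ → Trunc (a j) (e j) =>
        (∀ j, (fun i => evalAt (he j) (u j i)) ≠ 0) ∧ HasSmallMultiple B u with hS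
  have hfib : ∀ z ∈ Finset.univ.erase (0 : Fin ℓ → F),
      (S.filter fun u => (fun i => evalAt (he j₀) (u j₀ i)) = z).card =
      (S.filter fun u => (fun i => evalAt (he j₀) (u j₀ i)) = y).card := by
    intro z hz
    rw [hS, Finset.filter_filter, Finset.filter_filter]
    exact le_antisymm
      (card_hasSmallMultiple_fiber_le he B j₀ (Finset.ne_of_mem_erase hz) hy)
      (card_hasSmallMultiple_fiber_le he B j₀ hy (Finset.ne_of_mem_erase hz))
  have h1 : S.card = (Finset.univ.erase (0 : Fin ℓ → F)).card *
      (S.filter fun u => (fun i => evalAt (he j₀) (u j₀ i)) = y).card := by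
    rw [Finset.card_eq_sum_card_fiberwise (f := fun u i => evalAt (he j₀) (u j₀ i))
      (t := Finset.univ.erase (0 : Fin ℓ → F)), Finset.sum_congr rfl hfib, Finset.sum_const,
      smul_eq_mul]
    intro u hu
    have := (Finset.mem_filter.mp (Finset.mem_coe.mp hu)).2.1 j₀
    simpa using this
  have h2 := Finset.card_filter_add_card_filter_not (s := S)
    (fun u => (fun i => evalAt (he j₀) (u j₀ i)) = y)
  have hc : ((Finset.univ.erase (0 : Fin ℓ → F)).card : ℝ) = (Fintype.card F : ℝ) ^ ℓ - 1 := by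
    rw [Finset.card_erase_of_mem (Finset.mem_univ _), Finset.card_univ,
      Nat.cast_sub (by simpa using Nat.one_le_pow _ _ Fintype.card_pos)]
    simp
  have h1' := congrArg (Nat.cast : ℕ → ℝ) h1
  have h2' := congrArg (Nat.cast : ℕ → ℝ) h2
  push_cast at h1' h2'
  rw [hc] at h1'
  rw [← Finset.filter_filter, ← hS]
  change _ * (((S.filter fun u => ¬ (fun i => evalAt (he j₀) (u j₀ i)) = y).card : ℕ) : ℝ) = _
  linear_combination ((Fintype.card F : ℝ) ^ ℓ - 1) * h2' + h1'

open scoped Classical in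
/-- The number of primitive vectors with one value at `a` excluded. -/
theorem card_primitive_avoiding {a : F} {m : ℕ} (hm : 0 < m) (h2 : 2 ≤ Fintype.card F ^ ℓ)
    {y : Fin ℓ → F} (hy : y ≠ 0) :
    ((Finset.univ.filter fun u : Fin ℓ → Trunc a m =>
      (fun i => evalAt hm (u i)) ≠ 0 ∧ (fun i => evalAt hm (u i)) ≠ y).card : ℝ) =
      (Fintype.card F : ℝ) ^ (m * ℓ) * (1 - 1 / (Fintype.card F : ℝ) ^ ℓ) *
        (((Fintype.card F : ℝ) ^ ℓ - 2) / ((Fintype.card F : ℝ) ^ ℓ - 1)) := by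
  have h := card_filter_evalAt (a := a) (m := m) (ℓ := ℓ) hm ((Finset.univ.erase 0).erase y)
  have hc : ((Finset.univ.erase (0 : Fin ℓ → F)).erase y).card = Fintype.card F ^ ℓ - 2 := by
    rw [Finset.card_erase_of_mem (by simpa using hy), Finset.card_erase_of_mem (Finset.mem_univ _)]
    simp
    omega
  have hset : (Finset.univ.filter fun u : Fin ℓ → Trunc a m =>
      (fun i => evalAt hm (u i)) ∈ (Finset.univ.erase (0 : Fin ℓ → F)).erase y) =
      Finset.univ.filter fun u : Fin ℓ → Trunc a m =>
      (fun i => evalAt hm (u i)) ≠ 0 ∧ (fun i => evalAt hm (u i)) ≠ y := by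
    ext u
    simp only [Finset.mem_filter, Finset.mem_univ, true_and, Finset.mem_erase, and_true]
    exact and_comm
  rw [hset, hc] at h
  have h' := congrArg (Nat.cast : ℕ → ℝ) h
  push_cast [Nat.cast_sub h2] at h'
  have h2' : (2 : ℝ) ≤ (Fintype.card F : ℝ) ^ ℓ := by exact_mod_cast h2
  have hQ : (Fintype.card F : ℝ) ^ ℓ - 1 ≠ 0 := by linarith
  have hQ0 : (Fintype.card F : ℝ) ^ ℓ ≠ 0 := by linarith
  rw [← mul_left_inj' hQ0, h']
  field_simp

open scoped Classical in
/-- The probability bound. At the positions in `bad` the value `y_j` of `u_j(a_j)` is excluded.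
One of these restrictions is harmless by symmetry under the linear group, the others cost a factor
`(|F|^ℓ - 1) / (|F|^ℓ - 2)` each, and this is compensated by the factor `|F| - 1` gained from the
scaling of multipliers. -/
theorem card_hasSmallMultiple_mem_le (ha : Function.Injective a) (he : ∀ j, 0 < e j) {B : ℕ}
    (hB : B ≤ ∑ j, e j) (hℓ : 2 ≤ ℓ) (bad : Finset J) (hbad : bad.card < Fintype.card F)
    (y : J → Fin ℓ → F) (hy : ∀ j ∈ bad, y j ≠ 0)
    (S : Finset (∀ j, Fin ℓ → Trunc (a j) (e j)))
    (hS : ∀ u, u ∈ S ↔ ∀ j, (fun i => evalAt (he j) (u j i)) ≠ 0 ∧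
      (j ∈ bad → (fun i => evalAt (he j) (u j i)) ≠ y j)) :
    ((S.filter fun u => HasSmallMultiple B u).card : ℝ) ≤
      S.card * ((Fintype.card F : ℝ) ^ (B * ℓ) *
        ∏ j, (((Fintype.card F : ℝ) ^ e j - 1 / (Fintype.card F : ℝ) ^ ℓ) /
          ((Fintype.card F : ℝ) ^ (e j * ℓ) * (1 - 1 / (Fintype.card F : ℝ) ^ ℓ)))) := by
  set q : ℝ := (Fintype.card F : ℝ) with hq
  have hq2 : (2 : ℝ) ≤ q := by
    rw [hq]
    exact_mod_cast Fintype.one_lt_card (α := F)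
  set Q : ℝ := q ^ ℓ with hQ
  have hQq : q ^ 2 ≤ Q := pow_le_pow_right₀ (by linarith) hℓ
  have hQ4 : 4 ≤ Q := by nlinarith
  have hQ4' : 2 ≤ Fintype.card F ^ ℓ := by
    have : (2 : ℝ) ≤ ((Fintype.card F ^ ℓ : ℕ) : ℝ) := by
      rw [Nat.cast_pow]
      linarith
    exact_mod_cast this
  set s : ℝ := (Q - 2) / (Q - 1) with hs
  have hs0 : 0 ≤ s := div_nonneg (by linarith) (by linarith)
  -- the number of all families
  have hSpi : S = Fintype.piFinset fun j => if j ∈ bad then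
      Finset.univ.filter fun v : Fin ℓ → Trunc (a j) (e j) =>
        (fun i => evalAt (he j) (v i)) ≠ 0 ∧ (fun i => evalAt (he j) (v i)) ≠ y j
      else Finset.univ.filter fun v : Fin ℓ → Trunc (a j) (e j) =>
        (fun i => evalAt (he j) (v i)) ≠ 0 := by
    ext u
    rw [hS, Fintype.mem_piFinset]
    refine forall_congr' fun j => ?_
    split_ifs with h <;> simp [h]
  have hcard : (S.card : ℝ) = (∏ j, (q ^ (e j * ℓ) * (1 - 1 / Q))) * s ^ bad.card := by
    rw [hSpi, Fintype.card_piFinset, Nat.cast_prod]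
    have : s ^ bad.card = ∏ j, if j ∈ bad then s else 1 := by
      rw [Finset.prod_ite_mem, Finset.univ_inter, Finset.prod_const]
    rw [this, ← Finset.prod_mul_distrib]
    refine Finset.prod_congr rfl fun j _ => ?_
    split_ifs with h
    · exact card_primitive_avoiding (he j) hQ4' (hy j h)
    · rw [mul_one]
      exact card_primitive (he j)
  -- the number of families with a small multiple
  set A := Finset.univ.filter fun u : ∀ j, Fin ℓ → Trunc (a j) (e j) =>
        (∀ j, (fun i => evalAt (he j) (u j i)) ≠ 0) ∧ HasSmallMultiple B u with hA
  have hsub : (S.filter fun u => HasSmallMultiple B u) ⊆ A := by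
    intro u hu
    obtain ⟨h1, h2⟩ := Finset.mem_filter.mp hu
    exact Finset.mem_filter.mpr ⟨Finset.mem_univ _, fun j => ((hS u).mp h1 j).1, h2⟩
  have hkey : ((S.filter fun u => HasSmallMultiple B u).card : ℝ) ≤
      s ^ bad.card * ((q - 1) * A.card) := by
    rcases bad.eq_empty_or_nonempty with h0 | ⟨j₀, hj₀⟩
    · rw [h0, Finset.card_empty, pow_zero, one_mul]
      have h1 : ((S.filter fun u => HasSmallMultiple B u).card : ℝ) ≤ A.card :=
        Nat.cast_le.mpr (Finset.card_le_card hsub)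
      nlinarith [(Nat.cast_nonneg A.card : (0 : ℝ) ≤ A.card)]
    · have h1 : ((S.filter fun u => HasSmallMultiple B u).card : ℝ) ≤ s * A.card := by
        have h2 := card_hasSmallMultiple_avoiding (a := a) (e := e) he B j₀ (hy j₀ hj₀)
        rw [← hA, ← hq, ← hQ] at h2
        have h3 : s * A.card = ((Finset.univ.filter fun u : ∀ j, Fin ℓ → Trunc (a j) (e j) =>
            ((∀ j, (fun i => evalAt (he j) (u j i)) ≠ 0) ∧ HasSmallMultiple B u) ∧
            (fun i => evalAt (he j₀) (u j₀ i)) ≠ y j₀).card : ℝ) := by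
          rw [hs, div_mul_eq_mul_div, ← h2]
          field_simp [show Q - 1 ≠ 0 by linarith]
        rw [h3]
        refine Nat.cast_le.mpr (Finset.card_le_card fun u hu => ?_)
        obtain ⟨h4, h5⟩ := Finset.mem_filter.mp hu
        exact Finset.mem_filter.mpr ⟨Finset.mem_univ _,
          ⟨fun j => ((hS u).mp h4 j).1, h5⟩, ((hS u).mp h4 j₀).2 hj₀⟩
      obtain ⟨k, hk⟩ : ∃ k, bad.card = k + 1 :=
        ⟨bad.card - 1, (Nat.sub_add_cancel (Finset.card_pos.mpr ⟨j₀, hj₀⟩)).symm⟩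
      have hkq : (k : ℝ) + 2 ≤ q := by
        rw [hk] at hbad
        have : k + 2 ≤ Fintype.card F := hbad
        rw [hq]
        exact_mod_cast this
      -- Bernoulli's inequality: `1 ≤ s ^ k * (q - 1)`
      have hbern : 1 + (k : ℝ) * (s - 1) ≤ s ^ k := by
        have := one_add_mul_le_pow (a := s - 1) (by linarith) k
        simpa using this
      have hs1 : s - 1 = -(1 / (Q - 1)) := by
        rw [hs]
        field_simp [show Q - 1 ≠ 0 by linarith]
        ring
      have hk0 : (0 : ℝ) ≤ k := Nat.cast_nonneg k
      have h6 : 1 / (q - 1) ≤ s ^ k := by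
        refine le_trans ?_ hbern
        rw [hs1, mul_neg, ← sub_eq_add_neg, mul_one_div]
        have h7 : (k : ℝ) / (Q - 1) ≤ (q - 2) / (q ^ 2 - 1) := by
          gcongr
          · nlinarith
          · linarith
        refine le_trans ?_ (sub_le_sub_left h7 1)
        have : q ^ 2 - 1 = (q - 1) * (q + 1) := by ring
        rw [this, le_sub_iff_add_le, div_add_div _ _ (by linarith) (by nlinarith),
          div_le_one (by nlinarith [mul_pos (show 0 < q - 1 by linarith) (show 0 < q - 1 by linarith)])]
        nlinarith [mul_nonneg (show 0 ≤ q - 1 by linarith)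
          (mul_nonneg (show 0 ≤ q by linarith) (show 0 ≤ q - 2 by linarith))]
      rw [div_le_iff₀ (by linarith)] at h6
      refine h1.trans ?_
      rw [hk, pow_succ]
      have h8 : 0 ≤ s * A.card := mul_nonneg hs0 (Nat.cast_nonneg _)
      calc s * (A.card : ℝ) = 1 * (s * A.card) := (one_mul _).symm
        _ ≤ (s ^ k * (q - 1)) * (s * A.card) := mul_le_mul_of_nonneg_right h6 h8
        _ = _ := by ring
  have hunion := card_hasSmallMultiple_le (ℓ := ℓ) ha he hB
  rw [← hA, ← hq, ← hQ] at hunion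
  refine hkey.trans ((mul_le_mul_of_nonneg_left hunion (pow_nonneg hs0 _)).trans_eq ?_)
  rw [hcard, Finset.prod_div_distrib]
  have hpos : ∏ j, (q ^ (e j * ℓ) * (1 - 1 / Q)) ≠ 0 := by
    refine Finset.prod_ne_zero_iff.mpr fun j _ => mul_ne_zero (by positivity) ?_
    rw [sub_ne_zero]
    intro h
    rw [eq_div_iff (by linarith)] at h
    linarith
  have hcancel : ∀ P t T N : ℝ, P ≠ 0 → t * (T * N) = P * t * (T * (N / P)) := by
    intro P t T N hP
    field_simp
  exact hcancel _ _ _ _ hpos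

end Count

/-! ### The decoder when all solutions are multiples of the transmitted fraction -/

theorem vecDeg_mul {F : Type*} [Field F] {ℓ : ℕ} (p : F[X]) (v : F[X] × (Fin ℓ → F[X])) :
    vecDeg (p * v.1, fun i => p * v.2 i) = p.degree + vecDeg v := by
  have hmono : Monotone fun x : WithBot ℕ => p.degree + x := fun _ _ h => add_le_add_right h _
  unfold vecDeg
  rw [hmono.map_max]
  dsimp only
  rw [degree_mul]
  congr 1
  rw [Finset.apply_sup_eq_sup_comp_of_linearOrder (fun x => p.degree + x) hmono (by simp)]
  refine Finset.sup_congr rfl fun i _ => ?_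
  simp [degree_mul]

theorem vecDeg_ne_bot {F : Type*} [Field F] {ℓ : ℕ} {v : F[X] × (Fin ℓ → F[X])}
    (hv : v.1 ≠ 0) : vecDeg v ≠ ⊥ := by
  intro h
  have h1 : v.1.degree ≤ vecDeg v := le_max_left _ _
  rw [h, le_bot_iff, degree_eq_bot] at h1
  exact hv h1

/-- A vector proportional to `(g, f)` is a polynomial multiple of it, as `f / g` is reduced. -/
theorem RedFrac.exists_eq_mul {F : Type*} [Field F] {ℓ : ℕ} (h : RedFrac F ℓ)
    {φ : F[X]} {ψ : Fin ℓ → F[X]} (hv : ∀ i, φ * h.num i = ψ i * h.den) :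
    ∃ p : F[X], φ = p * h.den ∧ ∀ i, ψ i = p * h.num i := by
  classical
  have hdvd : h.den ∣ φ := by
    obtain ⟨g', hg'⟩ := EuclideanDomain.gcd_dvd_left h.den φ
    obtain ⟨φ', hφ'⟩ := EuclideanDomain.gcd_dvd_right h.den φ
    set d := EuclideanDomain.gcd h.den φ with hd
    have hd0 : d ≠ 0 := by
      rintro h0
      rw [h0, zero_mul] at hg'
      exact h.den_ne_zero hg'
    have hcop : IsCoprime g' φ' := by
      have hb := EuclideanDomain.gcd_eq_gcd_ab h.den φ
      rw [← hd] at hb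
      refine ⟨EuclideanDomain.gcdA h.den φ, EuclideanDomain.gcdB h.den φ, ?_⟩
      refine mul_left_cancel₀ hd0 ?_
      linear_combination (-1 : F[X]) * hb - EuclideanDomain.gcdA h.den φ * hg' -
        EuclideanDomain.gcdB h.den φ * hφ'
    have hu : IsUnit g' := by
      refine h.coprime g' ⟨d, by rw [mul_comm]; exact hg'⟩ fun i => ?_
      refine hcop.dvd_of_dvd_mul_left ⟨ψ i, ?_⟩
      refine mul_left_cancel₀ hd0 ?_
      linear_combination hv i - hφ' * h.num i + ψ i * hg'
    rw [hg', hφ']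
    exact mul_dvd_mul_left d (hu.dvd)
  obtain ⟨p, hp⟩ := hdvd
  refine ⟨p, by rw [hp, mul_comm], fun i => ?_⟩
  refine mul_right_cancel₀ h.den_ne_zero ?_
  rw [← hv i, hp]
  ring

/-- If all solutions are proportional to `(g, f)` and some multiple `Λ (g, f)` with `deg Λ ≤ t` is a
solution, then every run of the decoder returns `f / g`. -/
theorem decoderOutputs_eq_toRat {F : Type*} [Field F] {n ℓ : ℕ} {α : Fin n → F} {lam : Fin n → ℕ}
    {df dg t : ℕ} {R : ∀ j, RedSymb (α j) (lam j) ℓ} (h : RedFrac F ℓ)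
    (hf : ∀ i, (h.num i).degree < (df : WithBot ℕ)) (hg : h.den.degree < (dg : WithBot ℕ))
    (hsol : ∀ w ∈ solutions df dg t R, ∀ i, w.1 * h.num i = w.2 i * h.den)
    {Λ : F[X]} (hΛ0 : Λ ≠ 0) (hΛt : Λ.degree ≤ (t : WithBot ℕ))
    (hΛ : (Λ * h.den, fun i => Λ * h.num i) ∈ solutions df dg t R)
    {o : Option (Fin ℓ → RatFunc F)} (ho : o ∈ decoderOutputs df dg t R) : o = some h.toRat := by
  have hne : ∀ p : F[X], p ≠ 0 → (p * h.den, fun i => p * h.num i) ≠ 0 := by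
    intro p hp h0
    exact mul_ne_zero hp h.den_ne_zero (congrArg Prod.fst h0)
  rcases ho with ⟨hno, -⟩ | ⟨v, η, hv, hη, rfl⟩
  · exfalso
    obtain ⟨v, ⟨hv1, hv2⟩, hmin⟩ := WellFounded.has_min
      (InvImage.wf (vecDeg (F := F) (ℓ := ℓ)) (wellFounded_lt (α := WithBot ℕ)))
      {w | w ∈ solutions df dg t R ∧ w ≠ 0} ⟨_, hΛ, hne Λ hΛ0⟩
    exact hno v ⟨hv1, hv2, fun w hw hw0 => not_lt.mp (hmin w ⟨hw, hw0⟩)⟩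
  obtain ⟨p, hp1, hp2⟩ := h.exists_eq_mul (hsol v hv.1)
  have hvp : v = (p * h.den, fun i => p * h.num i) := Prod.ext hp1 (funext hp2)
  have hp0 : p ≠ 0 := by
    rintro rfl
    exact hv.2.1 (by rw [hvp]; ext <;> simp)
  have hpt : p.degree ≤ (t : WithBot ℕ) := by
    have h1 := hv.2.2 _ hΛ (hne Λ hΛ0)
    rw [hvp, vecDeg_mul p (h.den, h.num), vecDeg_mul Λ (h.den, h.num)] at h1
    exact (WithBot.le_of_add_le_add_right
      (vecDeg_ne_bot (v := (h.den, h.num)) h.den_ne_zero) h1).trans hΛt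
  obtain ⟨c, hc⟩ : p ∣ η :=
    hη.2 p (by rw [hp1]; exact dvd_mul_right _ _) fun i => by rw [hp2]; exact dvd_mul_right _ _
  have hcu : IsUnit c := by
    refine h.coprime c ?_ fun i => ?_
    · have := hη.1.1
      rwa [hp1, hc, mul_dvd_mul_iff_left hp0] at this
    · have := hη.1.2 i
      rwa [hp2, hc, mul_dvd_mul_iff_left hp0] at this
  have hη0 : η ≠ 0 := hc ▸ mul_ne_zero hp0 hcu.ne_zero
  have hden : c * (v.1 / η) = h.den := by
    refine mul_left_cancel₀ hp0 ?_
    rw [← mul_assoc, ← hc, EuclideanDomain.mul_div_cancel' hη0 hη.1.1, hp1]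
  have hnum : ∀ i, c * (v.2 i / η) = h.num i := by
    intro i
    refine mul_left_cancel₀ hp0 ?_
    rw [← mul_assoc, ← hc, EuclideanDomain.mul_div_cancel' hη0 (hη.1.2 i), hp2]
  have hdeg : ∀ x : F[X], (c * x).degree = x.degree := by
    intro x
    rw [degree_mul, degree_eq_zero_of_isUnit hcu, zero_add]
  have hcond : η.degree ≤ (t : WithBot ℕ) ∧ v.1 / η ≠ 0 ∧ (v.1 / η).degree < (dg : WithBot ℕ) ∧
      ∀ i, (v.2 i / η).degree < (df : WithBot ℕ) := by
    refine ⟨?_, ?_, ?_, fun i => ?_⟩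
    · rw [hc, degree_mul, degree_eq_zero_of_isUnit hcu, add_zero]
      exact hpt
    · intro h0
      rw [h0, mul_zero] at hden
      exact h.den_ne_zero hden.symm
    · rw [← hdeg, hden]; exact hg
    · rw [← hdeg, hnum]; exact hf i
  unfold finalStep
  rw [if_pos hcond]
  congr 1
  funext i
  unfold RedFrac.toRat
  rw [← hnum i, ← hden, map_mul, map_mul]
  have hc0 : algebraMap F[X] (RatFunc F) c ≠ 0 := by
    rw [Ne, FaithfulSMul.algebraMap_eq_zero_iff]
    exact hcu.ne_zero
  rw [mul_div_mul_left _ _ hc0]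

/-! ### The key equations at one evaluation point -/

/-- The first component of a solution is divisible by `(x - a)^ϱ`, as the symbol is reduced. -/
theorem pow_dvd_of_keyEquation {F : Type*} [Field F] {a : F} {m ℓ : ℕ} {s : Symb a m ℓ}
    (hs : IsReducedSymb s) {φ : F[X]} {ψ : Fin ℓ → F[X]}
    (hsol : ∀ i, red a m ((X - C a) ^ (s.1 : ℕ) * ψ i) = red a m φ * s.2 i) :
    (X - C a) ^ (s.1 : ℕ) ∣ φ := by
  rcases Nat.eq_zero_or_pos (s.1 : ℕ) with h0 | hpos
  · rw [h0, pow_zero]; exact one_dvd _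
  obtain ⟨i, hi⟩ := hs hpos
  have hm : (s.1 : ℕ) ≤ m := Nat.lt_succ_iff.mp s.1.2
  have h1 := hsol i
  rw [← red_lift (s.2 i)] at h1 hi
  rw [← map_mul, red_eq_red_iff] at h1
  have h2 : (X - C a) ^ (s.1 : ℕ) ∣ φ * lift (s.2 i) :=
    (dvd_sub_right (dvd_mul_right _ _)).mp ((pow_dvd_pow _ hm).trans h1)
  have h3 : ¬ (X - C a) ∣ lift (s.2 i) := fun hd => hi (map_dvd _ hd)
  exact (((irreducible_X_sub_C a).coprime_iff_not_dvd.mpr h3).pow_left).dvd_of_dvd_mul_right h2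

/-- For a solution `(φ' (x - a)^ϱ, ψ)` of the key equations, `φ f - ψ g` is expressed by the
residual of `(g, f)` in these equations. -/
theorem red_cross_eq {F : Type*} [Field F] {a : F} {m ϱ : ℕ} {φ φ' ψ f g : F[X]} {r : Trunc a m}
    (hφ : φ = (X - C a) ^ ϱ * φ') (hg : (X - C a) ^ ϱ ∣ g)
    (hsol : red a m ((X - C a) ^ ϱ * ψ) = red a m φ * r) :
    red a m (φ * f - ψ * g) = red a m φ' * (red a m ((X - C a) ^ ϱ * f) - red a m g * r) := by
  obtain ⟨g', rfl⟩ := hg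
  subst hφ
  simp only [map_mul, map_sub] at hsol ⊢
  linear_combination - red a m g' * hsol

theorem isUnit_red {F : Type*} [Field F] {a : F} {m : ℕ} {p : F[X]}
    (h : IsCoprime (X - C a) p) : IsUnit (red a m p) := by
  obtain ⟨u, w, huw⟩ := h.pow_left (m := m)
  refine IsUnit.of_mul_eq_one (red a m w) ?_
  rw [← map_mul, ← map_one (red a m), red_eq_red_iff]
  exact ⟨-u, by linear_combination huw⟩

/-- The defining property of `𝒮(f/g)`, cleared of denominators. -/
theorem red_den_mul_evRed {F : Type*} [Field F] {ℓ : ℕ} (h : RedFrac F ℓ) (a : F) (m : ℕ)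
    (i : Fin ℓ) :
    red a m h.den * evRed h a m i = red a m ((X - C a) ^ polyVal a m h.den * h.num i) := by
  classical
  by_cases hv : polyVal a m h.den = m
  · rw [polyVal_eq_iff_red_eq_zero.mp hv, zero_mul, eq_comm, red_eq_zero_iff, hv]
    exact dvd_mul_right _ _
  · have hlt := lt_of_le_of_ne (polyVal_le a m h.den) hv
    have hq : h.den = (X - C a) ^ polyVal a m h.den * (h.den / (X - C a) ^ polyVal a m h.den) :=
      (EuclideanDomain.mul_div_cancel' (pow_ne_zero _ (X_sub_C_ne_zero a))
        (pow_polyVal_dvd a m h.den)).symm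
    set g' := h.den / (X - C a) ^ polyVal a m h.den with hg'
    have hu : IsUnit (red a m g') :=
      isUnit_red ((irreducible_X_sub_C a).coprime_iff_not_dvd.mpr
        (not_dvd_of_eq_pow_polyVal_mul hq hlt))
    have hS : evRed h a m i = red a m (h.num i) * Ring.inverse (red a m g') := by
      unfold evRed
      rw [if_neg hv]
    rw [hS]
    conv_lhs => rw [hq]
    rw [map_mul, map_mul, map_pow]
    calc _ = red a m (X - C a) ^ polyVal a m h.den * red a m (h.num i) *
          (red a m g' * Ring.inverse (red a m g')) := by ring
      _ = _ := by rw [Ring.mul_inverse_cancel _ hu, mul_one]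

theorem symbEquiv_val_eq {F : Type*} [Field F] {a : F} {m ℓ : ℕ} {s s' : RedSymb a m ℓ}
    (h : (Quotient.mk _ s : RecSymb a m ℓ) = Quotient.mk _ s') : (s.1.1 : ℕ) = s'.1.1 :=
  congrArg RecSymb.val h

/-- The residual of `(g, f)` in the key equation of a symbol with the correct valuation, whose
reduction part has the error `ε`; it does not depend on the representative. -/
theorem residual_eq {F : Type*} [Field F] {a : F} {m ℓ : ℕ} (h : RedFrac F ℓ)
    {s s' : RedSymb a m ℓ} (hss : (Quotient.mk _ s : RecSymb a m ℓ) = Quotient.mk _ s')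
    (hv : (s.1.1 : ℕ) = polyVal a m h.den) {ε : Fin ℓ → F[X]}
    (hε : ∀ i, s.1.2 i = evRed h a m i + red a m (ε i)) (i : Fin ℓ) :
    red a m ((X - C a) ^ (s'.1.1 : ℕ) * h.num i) - red a m h.den * s'.1.2 i =
      - red a m (h.den * ε i) := by
  have hval := symbEquiv_val_eq hss
  have he : red a m ((X - C a) ^ (s'.1.1 : ℕ)) * s.1.2 i =
      red a m ((X - C a) ^ (s.1.1 : ℕ)) * s'.1.2 i := (Quotient.exact hss : SymbEquiv s.1 s'.1) i
  rw [← hval, hv, hε] at he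
  obtain ⟨g', hg'⟩ := pow_polyVal_dvd a m h.den
  have hS := red_den_mul_evRed h a m i
  rw [← hval, hv, ← hS]
  have hg2 := congrArg (red a m) hg'
  rw [map_mul] at hg2 ⊢
  linear_combination red a m g' * he + (evRed h a m i + red a m (ε i) - s'.1.2 i) * hg2

/-! ### Parametrization of the received words by the errors -/

/-- The symbol with the correct valuation and with error `(x - a)^k u` in the reduction part. -/
def errSymb {F : Type*} [Field F] {ℓ : ℕ} (h : RedFrac F ℓ) (a : F) (m k : ℕ) {d : ℕ}
    (u : Fin ℓ → Trunc a d) : Symb a m ℓ :=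
  (⟨polyVal a m h.den, Nat.lt_succ_of_le (polyVal_le a m h.den)⟩,
    fun i => evRed h a m i + red a m ((X - C a) ^ k * lift (u i)))

theorem eval_lift {F : Type*} [Field F] {a : F} {m : ℕ} (hm : 0 < m) (x : Trunc a m) :
    (lift x).eval a = evalAt hm x := by
  conv_rhs => rw [← red_lift x, evalAt_red]

theorem evalAt_red_pow_mul_lift {F : Type*} [Field F] {a : F} {m k d : ℕ} (hm : 0 < m)
    (hd : 0 < d) (x : Trunc a d) :
    evalAt hm (red a m ((X - C a) ^ k * lift x)) = if k = 0 then evalAt hd x else 0 := by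
  rw [evalAt_red]
  split_ifs with hk
  · simp [hk, eval_lift hd]
  · simp [hk]

theorem evalAt_evRed_ne_zero {F : Type*} [Field F] {ℓ : ℕ} (h : RedFrac F ℓ) (a : F) {m : ℕ}
    (hm : 0 < m) (hv : 0 < polyVal a m h.den) : (fun i => evalAt hm (evRed h a m i)) ≠ 0 := by
  obtain ⟨i, hi⟩ := evRed_isReduced h a m hv
  intro h0
  exact hi ((dvd_iff_evalAt hm _).mpr (congrFun h0 i))

/-- The symbol with error `(x - a)^k u` is reduced unless `x - a` divides the denominator, `k = 0`
and the error cancels the correct value at `a`. -/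
theorem isReducedSymb_errSymb_iff {F : Type*} [Field F] {ℓ : ℕ} (h : RedFrac F ℓ) (a : F)
    {m k d : ℕ} (hm : 0 < m) (hd : 0 < d) (u : Fin ℓ → Trunc a d) :
    IsReducedSymb (errSymb h a m k u) ↔ (0 < polyVal a m h.den ∧ k = 0 →
      (fun i => evalAt hd (u i)) ≠ fun i => -evalAt hm (evRed h a m i)) := by
  have h1 : IsReducedSymb (errSymb h a m k u) ↔ (0 < polyVal a m h.den →
      ∃ i, evalAt hm (evRed h a m i) + (if k = 0 then evalAt hd (u i) else 0) ≠ 0) := by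
    unfold IsReducedSymb
    refine imp_congr Iff.rfl (exists_congr fun i => not_congr ?_)
    rw [dvd_iff_evalAt hm]
    change evalAt hm (evRed h a m i + red a m ((X - C a) ^ k * lift (u i))) = 0 ↔ _
    rw [map_add, evalAt_red_pow_mul_lift hm hd]
  rw [h1]
  by_cases hv : 0 < polyVal a m h.den
  · by_cases hk : k = 0
    · simp only [hv, hk, if_true, true_and, forall_true_left]
      rw [Function.ne_iff]
      refine exists_congr fun i => not_congr ?_
      rw [add_comm, add_eq_zero_iff_eq_neg]
    · simp only [hv, hk, if_false, add_zero, and_false, false_implies, forall_true_left, iff_true]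
      exact Function.ne_iff.mp (evalAt_evRed_ne_zero h a hm hv)
  · simp [hv]

theorem pow_dvd_of_le_vecVal {F : Type*} [Field F] {a : F} {m ℓ k : ℕ} {r : Fin ℓ → Trunc a m}
    (hk : k ≤ vecVal r) (i : Fin ℓ) : red a m ((X - C a) ^ k) ∣ r i := by
  classical
  have h1 := Nat.findGreatest_spec (P := fun k => ∀ i, red a m ((X - C a) ^ k) ∣ r i)
    (Nat.zero_le m) (by simp) i
  exact (_root_.map_dvd _ (pow_dvd_pow _ hk)).trans h1

theorem le_vecVal {F : Type*} [Field F] {a : F} {m ℓ k : ℕ} {r : Fin ℓ → Trunc a m} (hk : k ≤ m)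
    (h : ∀ i, red a m ((X - C a) ^ k) ∣ r i) : k ≤ vecVal r := by
  classical
  exact Nat.le_findGreatest (P := fun k => ∀ i, red a m ((X - C a) ^ k) ∣ r i) hk h

/-- The vector `(x - a)^k w` has truncated valuation `k < m` iff `w` does not vanish at `a`. -/
theorem vecVal_eq_iff {F : Type*} [Field F] {a : F} {m ℓ k : ℕ} (hk : k < m) (w : Fin ℓ → F[X]) :
    vecVal (fun i => red a m ((X - C a) ^ k * w i)) = k ↔ (fun i => (w i).eval a) ≠ 0 := by
  have h1 : (∀ i, red a m ((X - C a) ^ (k + 1)) ∣ red a m ((X - C a) ^ k * w i)) ↔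
      (fun i => (w i).eval a) = 0 := by
    rw [funext_iff]
    refine forall_congr' fun i => ?_
    rw [red_dvd_iff hk, pow_succ, mul_dvd_mul_iff_left (pow_ne_zero _ (X_sub_C_ne_zero a)),
      dvd_iff_isRoot]
    rfl
  have h2 : k ≤ vecVal (fun i => red a m ((X - C a) ^ k * w i)) :=
    le_vecVal hk.le fun i => map_dvd _ (dvd_mul_right _ _)
  constructor
  · intro h3 h4
    have := le_vecVal hk (h1.mpr h4)
    omega
  · intro h3
    by_contra h4
    exact h3 (h1.mp fun i => pow_dvd_of_le_vecVal (lt_of_le_of_ne h2 (Ne.symm h4)) i)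

/-- The symbols of the error model at an evaluation error are those given by a primitive `u`. -/
theorem exists_errSymb_iff {F : Type*} [Field F] {ℓ : ℕ} (h : RedFrac F ℓ) (a : F)
    {m μ : ℕ} (hv : polyVal a m h.den ≤ μ) (hμ : μ < m) (S : RecSymb a m ℓ) :
    (∃ s : RedSymb a m ℓ, S = Quotient.mk _ s ∧ (s.1.1 : ℕ) = polyVal a m h.den ∧
      vecVal (s.1.2 - evRed h a m) = μ - polyVal a m h.den) ↔
    ∃ u : Fin ℓ → Trunc a (m - μ), (fun i => evalAt (Nat.sub_pos_of_lt hμ) (u i)) ≠ 0 ∧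
      ∃ hr : IsReducedSymb (errSymb h a m (μ - polyVal a m h.den) u),
        S = Quotient.mk _ ⟨_, hr⟩ := by
  have hm : 0 < m := by omega
  have hd : 0 < m - μ := by omega
  set v := polyVal a m h.den with hvdef
  constructor
  · rintro ⟨s, rfl, hs1, hs2⟩
    have h1 := fun i => pow_dvd_of_le_vecVal hs2.ge i
    choose c hc using h1
    have hw : ∀ i, s.1.2 i = evRed h a m i + red a m ((X - C a) ^ (μ - v) * lift (c i)) := by
      intro i
      rw [map_mul, red_lift, ← hc i]
      simp
    have hw0 : (fun i => (lift (c i)).eval a) ≠ 0 := by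
      rw [← vecVal_eq_iff (m := m) (k := μ - v) (by omega), ← hs2]
      congr 1
      funext i
      rw [hc i, map_mul, red_lift, hs2]
    -- the representative given by the errors modulo `(x - a)^(m - μ)`
    have heval : ∀ i, evalAt hd (red a (m - μ) (lift (c i))) = (lift (c i)).eval a :=
      fun i => evalAt_red hd _
    have hr : IsReducedSymb (errSymb h a m (μ - v) fun i => red a (m - μ) (lift (c i))) := by
      intro hpos
      obtain ⟨i, hi⟩ := s.2 (by rw [hs1]; exact hpos)
      refine ⟨i, ?_⟩
      rw [dvd_iff_evalAt hm] at hi ⊢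
      intro h0
      apply hi
      rw [hw i]
      change evalAt hm (evRed h a m i + red a m _) = 0 at h0
      rw [map_add, evalAt_red_pow_mul_lift hm hd, heval] at h0
      rwa [map_add, evalAt_red_pow_mul_lift hm hm, ← eval_lift hm (c i)]
    refine ⟨fun i => red a (m - μ) (lift (c i)), ?_, hr, ?_⟩
    · simp only [heval]
      exact hw0
    · refine Quotient.sound fun i => ?_
      change red a m ((X - C a) ^ v) * s.1.2 i = red a m ((X - C a) ^ (s.1.1 : ℕ)) *
        (evRed h a m i + red a m ((X - C a) ^ (μ - v) * lift (red a (m - μ) (lift (c i)))))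
      rw [hs1, hw i, mul_add, mul_add, ← map_mul, ← map_mul, ← mul_assoc, ← mul_assoc,
        ← pow_add, red_pow_mul_lift_red (by omega)]
  · rintro ⟨u, hu, hr, rfl⟩
    refine ⟨⟨_, hr⟩, rfl, rfl, ?_⟩
    have h1 : (errSymb h a m (μ - v) u).2 - evRed h a m =
        fun i => red a m ((X - C a) ^ (μ - v) * lift (u i)) := by
      funext i
      change evRed h a m i + red a m ((X - C a) ^ (μ - v) * lift (u i)) - evRed h a m i = _
      rw [add_sub_cancel_left]
    change vecVal ((errSymb h a m (μ - v) u).2 - evRed h a m) = μ - v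
    rw [h1, vecVal_eq_iff (by omega)]
    intro h0
    apply hu
    rw [← h0]
    funext i
    exact (eval_lift _ _).symm

theorem errSymb_injective {F : Type*} [Field F] {ℓ : ℕ} (h : RedFrac F ℓ) (a : F)
    {m μ : ℕ} (hv : polyVal a m h.den ≤ μ) (hμ : μ < m) {u u' : Fin ℓ → Trunc a (m - μ)}
    (hr : IsReducedSymb (errSymb h a m (μ - polyVal a m h.den) u))
    (hr' : IsReducedSymb (errSymb h a m (μ - polyVal a m h.den) u'))
    (huu : (Quotient.mk _ ⟨_, hr⟩ : RecSymb a m ℓ) = Quotient.mk _ ⟨_, hr'⟩) : u = u' := by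
  set v := polyVal a m h.den with hvdef
  funext i
  have h1 : red a m ((X - C a) ^ v) * (evRed h a m i + red a m ((X - C a) ^ (μ - v) * lift (u i))) =
      red a m ((X - C a) ^ v) * (evRed h a m i + red a m ((X - C a) ^ (μ - v) * lift (u' i))) :=
    (Quotient.exact huu : SymbEquiv _ _) i
  rw [mul_add, mul_add, add_right_inj, ← map_mul, ← map_mul, ← mul_assoc, ← mul_assoc,
    ← pow_add, red_eq_red_iff, ← mul_sub, Nat.add_sub_cancel' hv] at h1
  have h2 : m = μ + (m - μ) := by omega
  have h3 : (X - C a) ^ μ * (X - C a) ^ (m - μ) ∣ (X - C a) ^ μ * (lift (u i) - lift (u' i)) := by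
    rw [← pow_add, ← h2]; exact h1
  rw [mul_dvd_mul_iff_left (pow_ne_zero _ (X_sub_C_ne_zero a)), ← red_eq_red_iff,
    red_lift, red_lift] at h3
  exact h3

open scoped Classical in
/-- The word with evaluation errors `u`. (For `u` such that the symbol at `j ∈ ξe` is not reduced,
the value at `j` is irrelevant.) -/
def errWord {F : Type*} [Field F] {n ℓ : ℕ} (α : Fin n → F) (lam : Fin n → ℕ)
    (h : RedFrac F ℓ) (ξv ξe : Finset (Fin n)) (μ : Fin n → ℕ) (P : Word α lam ℓ)
    (u : ∀ j : {j // j ∈ ξe}, Fin ℓ → Trunc (α j) (lam j - μ j)) : Word α lam ℓ := fun j =>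
  if hj : j ∈ ξe then
    if hr : IsReducedSymb (errSymb h (α j) (lam j) (μ j - polyVal (α j) (lam j) h.den) (u ⟨j, hj⟩))
    then Quotient.mk _ ⟨_, hr⟩ else P j
  else if j ∈ ξv then P j else encode α lam h j

section Word

variable {F : Type*} [Field F] {n ℓ : ℕ} {α : Fin n → F} {lam : Fin n → ℕ}
  {h : RedFrac F ℓ} {ξv ξe : Finset (Fin n)} {μ : Fin n → ℕ} {P : Word α lam ℓ}

theorem errWord_of_mem_evaluation {u : ∀ j : {j // j ∈ ξe}, Fin ℓ → Trunc (α j) (lam j - μ j)}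
    {j : Fin n} (hj : j ∈ ξe) (hr : IsReducedSymb (errSymb h (α j) (lam j)
      (μ j - polyVal (α j) (lam j) h.den) (u ⟨j, hj⟩))) :
    errWord α lam h ξv ξe μ P u j = Quotient.mk _ ⟨_, hr⟩ := by
  unfold errWord
  rw [dif_pos hj, dif_pos hr]

theorem errWord_of_mem_valuation (hpat : IsErrorPattern α lam h ξv ξe μ P)
    {u : ∀ j : {j // j ∈ ξe}, Fin ℓ → Trunc (α j) (lam j - μ j)}
    {j : Fin n} (hj : j ∈ ξv) : errWord α lam h ξv ξe μ P u j = P j := by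
  unfold errWord
  rw [dif_neg fun h1 => Finset.disjoint_left.mp hpat.disjoint h1 hj, if_pos hj]

theorem errWord_of_notMem {u : ∀ j : {j // j ∈ ξe}, Fin ℓ → Trunc (α j) (lam j - μ j)}
    {j : Fin n} (hj : j ∉ ξe ∪ ξv) : errWord α lam h ξv ξe μ P u j = encode α lam h j := by
  rw [Finset.mem_union, not_or] at hj
  unfold errWord
  rw [dif_neg hj.1, if_neg hj.2]

/-- The families of errors that lead to received words: `u_j` is primitive and the symbol with
error `u_j` is reduced. -/
def errSet (hpat : IsErrorPattern α lam h ξv ξe μ P) :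
    Set (∀ j : {j // j ∈ ξe}, Fin ℓ → Trunc (α j) (lam j - μ j)) :=
  {u | ∀ j : {j // j ∈ ξe},
    (fun i => evalAt (Nat.sub_pos_of_lt (hpat.evaluation j j.2).2) (u j i)) ≠ 0 ∧
    IsReducedSymb (errSymb h (α j) (lam j) (μ j - polyVal (α j) (lam j) h.den) (u j))}

theorem image_errWord (hpat : IsErrorPattern α lam h ξv ξe μ P) :
    errWord α lam h ξv ξe μ P '' errSet hpat = receivedSet α lam h ξv ξe μ P := by
  ext R
  constructor
  · rintro ⟨u, hu, rfl⟩
    refine ⟨fun j hj => errWord_of_notMem hj, fun j hj => errWord_of_mem_valuation hpat hj,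
      fun j hj => ?_⟩
    obtain ⟨hu1, hu2⟩ := hu ⟨j, hj⟩
    exact (exists_errSymb_iff h (α j) (hpat.evaluation j hj).1 (hpat.evaluation j hj).2 _).mpr
      ⟨u ⟨j, hj⟩, hu1, hu2, errWord_of_mem_evaluation hj hu2⟩
  · rintro ⟨hR1, hR2, hR3⟩
    have h1 := fun j : {j // j ∈ ξe} =>
      (exists_errSymb_iff h (α j) (hpat.evaluation j j.2).1 (hpat.evaluation j j.2).2 _).mp
        (hR3 j j.2)
    choose u hu hr hR using h1
    refine ⟨u, fun j => ⟨hu j, hr j⟩, funext fun j => ?_⟩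
    by_cases hj : j ∈ ξe
    · rw [errWord_of_mem_evaluation hj (hr ⟨j, hj⟩)]
      exact (hR ⟨j, hj⟩).symm
    · by_cases hj' : j ∈ ξv
      · rw [errWord_of_mem_valuation hpat hj', hR2 j hj']
      · have hjj : j ∉ ξe ∪ ξv := by simp [hj, hj']
        rw [errWord_of_notMem hjj, hR1 j hjj]

theorem injOn_errWord (hpat : IsErrorPattern α lam h ξv ξe μ P) :
    Set.InjOn (errWord α lam h ξv ξe μ P) (errSet hpat) := by
  intro u hu u' hu' huu
  funext j
  have h1 := congrFun huu j
  rw [errWord_of_mem_evaluation j.2 (hu j).2, errWord_of_mem_evaluation j.2 (hu' j).2] at h1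
  exact errSymb_injective h (α j) (hpat.evaluation j j.2).1 (hpat.evaluation j j.2).2 _ _ h1

end Word

/-! ### Decoding failures yield small multiples of the errors -/

section Failure

variable {F : Type*} [Field F] {n ℓ : ℕ} {α : Fin n → F} {lam : Fin n → ℕ}
  {h : RedFrac F ℓ} {ξv ξe : Finset (Fin n)} {μ : Fin n → ℕ} {P : Word α lam ℓ}

/-- At an evaluation error `u_j` the residual of `(g, f)` is `-(x - α_j)^(μ_j - v) g u_j`. -/
theorem residual_errWord (hpat : IsErrorPattern α lam h ξv ξe μ P)
    {u : ∀ j : {j // j ∈ ξe}, Fin ℓ → Trunc (α j) (lam j - μ j)} (hu : u ∈ errSet hpat)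
    {R : ∀ j, RedSymb (α j) (lam j) ℓ}
    (hR : ∀ j, (Quotient.mk _ (R j) : RecSymb _ _ _) = errWord α lam h ξv ξe μ P u j)
    (j : {j // j ∈ ξe}) (i : Fin ℓ) :
    red (α j) (lam j) ((X - C (α j)) ^ ((R j).1.1 : ℕ) * h.num i) -
      red (α j) (lam j) h.den * (R j).1.2 i =
      - red (α j) (lam j) (h.den *
        ((X - C (α j)) ^ (μ j - polyVal (α j) (lam j) h.den) * lift (u j i))) := by
  have h1 := hR j
  rw [errWord_of_mem_evaluation j.2 (hu j).2] at h1
  exact residual_eq h h1.symm rfl (fun _ => rfl) i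

theorem residual_of_notMem {u : ∀ j : {j // j ∈ ξe}, Fin ℓ → Trunc (α j) (lam j - μ j)}
    {R : ∀ j, RedSymb (α j) (lam j) ℓ}
    (hR : ∀ j, (Quotient.mk _ (R j) : RecSymb _ _ _) = errWord α lam h ξv ξe μ P u j)
    {j : Fin n} (hj : j ∉ ξe ∪ ξv) (i : Fin ℓ) :
    red (α j) (lam j) ((X - C (α j)) ^ ((R j).1.1 : ℕ) * h.num i) -
      red (α j) (lam j) h.den * (R j).1.2 i = 0 := by
  have h1 := hR j
  rw [errWord_of_notMem hj] at h1
  have h2 := residual_eq h h1.symm rfl (ε := fun _ => 0) (fun _ => by rw [map_zero, add_zero]) i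
  rw [h2, mul_zero, map_zero, neg_zero]

/-- At a valuation error both the received valuation and that of `g` are at least `μ_j`. -/
theorem le_val_of_mem_valuation (hpat : IsErrorPattern α lam h ξv ξe μ P)
    {u : ∀ j : {j // j ∈ ξe}, Fin ℓ → Trunc (α j) (lam j - μ j)}
    {R : ∀ j, RedSymb (α j) (lam j) ℓ}
    (hR : ∀ j, (Quotient.mk _ (R j) : RecSymb _ _ _) = errWord α lam h ξv ξe μ P u j)
    {j : Fin n} (hj : j ∈ ξv) :
    μ j ≤ ((R j).1.1 : ℕ) ∧ (X - C (α j)) ^ μ j ∣ h.den := by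
  have h1 := hR j
  rw [errWord_of_mem_valuation hpat hj] at h1
  have h2 : ((R j).1.1 : ℕ) = (P j).val := congrArg RecSymb.val h1
  have h3 := (hpat.valuation j hj).1
  refine ⟨?_, (pow_dvd_pow _ h3).trans (pow_polyVal_dvd _ _ _)⟩
  rw [h2]
  rcases h3.lt_or_eq with h4 | h4
  · exact (hpat.partial_lt j hj h4).ge
  · exact h4.le.trans (hpat.partial_eq j hj h4).le

/-- `(g, f)` satisfies the key equations up to precision `μ_j`. -/
theorem pow_dvd_residual (hpat : IsErrorPattern α lam h ξv ξe μ P)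
    {u : ∀ j : {j // j ∈ ξe}, Fin ℓ → Trunc (α j) (lam j - μ j)} (hu : u ∈ errSet hpat)
    {R : ∀ j, RedSymb (α j) (lam j) ℓ}
    (hR : ∀ j, (Quotient.mk _ (R j) : RecSymb _ _ _) = errWord α lam h ξv ξe μ P u j)
    (j : Fin n) (i : Fin ℓ) :
    red (α j) (lam j) ((X - C (α j)) ^ μ j) ∣
      red (α j) (lam j) ((X - C (α j)) ^ ((R j).1.1 : ℕ) * h.num i) -
      red (α j) (lam j) h.den * (R j).1.2 i := by
  by_cases hj : j ∈ ξe ∪ ξv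
  · rcases Finset.mem_union.mp hj with hj | hj
    · rw [residual_errWord hpat hu hR ⟨j, hj⟩ i]
      refine (_root_.map_dvd (red (α j) (lam j)) ?_).neg_right
      have h1 := (hpat.evaluation j hj).1
      rw [← mul_assoc]
      refine Dvd.dvd.mul_right ?_ _
      conv_lhs => rw [← Nat.add_sub_cancel' h1, pow_add]
      exact mul_dvd_mul_right (pow_polyVal_dvd _ _ _) _
    · obtain ⟨h1, h2⟩ := le_val_of_mem_valuation hpat hR hj
      exact dvd_sub (_root_.map_dvd _ ((pow_dvd_pow _ h1).mul_right _))
        ((_root_.map_dvd _ h2).mul_right _)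
  · rw [residual_of_notMem hR hj i]
    exact dvd_zero _

theorem val_eq_polyVal (hpat : IsErrorPattern α lam h ξv ξe μ P)
    {u : ∀ j : {j // j ∈ ξe}, Fin ℓ → Trunc (α j) (lam j - μ j)} (hu : u ∈ errSet hpat)
    {R : ∀ j, RedSymb (α j) (lam j) ℓ}
    (hR : ∀ j, (Quotient.mk _ (R j) : RecSymb _ _ _) = errWord α lam h ξv ξe μ P u j)
    {j : Fin n} (hj : j ∉ ξv) : ((R j).1.1 : ℕ) = polyVal (α j) (lam j) h.den := by
  have h1 := hR j
  by_cases hje : j ∈ ξe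
  · rw [errWord_of_mem_evaluation hje (hu ⟨j, hje⟩).2] at h1
    exact symbEquiv_val_eq h1
  · rw [errWord_of_notMem (by simp [hj, hje])] at h1
    exact symbEquiv_val_eq h1

/-- For a solution `(φ, ψ)` the vector `φ f - ψ g` vanishes up to precision `μ_j`; at an
evaluation error, its leading part is a multiple of the error `u_j`. -/
theorem cross_eq (hpat : IsErrorPattern α lam h ξv ξe μ P)
    {u : ∀ j : {j // j ∈ ξe}, Fin ℓ → Trunc (α j) (lam j - μ j)} (hu : u ∈ errSet hpat)
    {R : ∀ j, RedSymb (α j) (lam j) ℓ}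
    (hR : ∀ j, (Quotient.mk _ (R j) : RecSymb _ _ _) = errWord α lam h ξv ξe μ P u j)
    {φ : F[X]} {ψ : Fin ℓ → F[X]}
    (hsol : ∀ i j, red (α j) (lam j) ((X - C (α j)) ^ ((R j).1.1 : ℕ) * ψ i) =
      red (α j) (lam j) φ * (R j).1.2 i) (j : {j // j ∈ ξe}) :
    ∃ b : F[X], ∀ i, (X - C (α j)) ^ lam j ∣
      φ * h.num i - ψ i * h.den - (X - C (α j)) ^ μ j * (b * lift (u j i)) := by
  have hval := val_eq_polyVal hpat hu hR (Finset.disjoint_left.mp hpat.disjoint j.2)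
  obtain ⟨φ', hφ⟩ := pow_dvd_of_keyEquation (R j).2 (hsol · j)
  obtain ⟨g', hg'⟩ := pow_polyVal_dvd (α j) (lam j) h.den
  refine ⟨- (φ' * g'), fun i => ?_⟩
  rw [← red_eq_red_iff, red_cross_eq hφ (hval ▸ pow_polyVal_dvd _ _ _) (hsol i j),
    residual_errWord hpat hu hR j i]
  have h1 : (X - C (α j)) ^ μ j = (X - C (α j)) ^ polyVal (α j) (lam j) h.den *
      (X - C (α j)) ^ (μ j - polyVal (α j) (lam j) h.den) := by
    rw [← pow_add, Nat.add_sub_cancel' (hpat.evaluation j j.2).1]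
  rw [← map_neg, ← map_mul, h1]
  congr 1
  linear_combination - φ' * (X - C (α j)) ^ (μ j - polyVal (α j) (lam j) h.den) *
    lift (u j i) * hg'

theorem pow_dvd_cross (hpat : IsErrorPattern α lam h ξv ξe μ P)
    {u : ∀ j : {j // j ∈ ξe}, Fin ℓ → Trunc (α j) (lam j - μ j)} (hu : u ∈ errSet hpat)
    {R : ∀ j, RedSymb (α j) (lam j) ℓ}
    (hR : ∀ j, (Quotient.mk _ (R j) : RecSymb _ _ _) = errWord α lam h ξv ξe μ P u j)
    {φ : F[X]} {ψ : Fin ℓ → F[X]}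
    (hsol : ∀ i j, red (α j) (lam j) ((X - C (α j)) ^ ((R j).1.1 : ℕ) * ψ i) =
      red (α j) (lam j) φ * (R j).1.2 i) (j : Fin n) (i : Fin ℓ) :
    (X - C (α j)) ^ μ j ∣ φ * h.num i - ψ i * h.den := by
  by_cases hj : j ∈ ξe ∪ ξv
  · rcases Finset.mem_union.mp hj with hj | hj
    · obtain ⟨b, hb⟩ := cross_eq hpat hu hR hsol ⟨j, hj⟩
      have h1 := (pow_dvd_pow (X - C (α j)) (hpat.evaluation j hj).2.le).trans (hb i)
      exact (dvd_sub_left (dvd_mul_right _ _)).mp h1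
    · obtain ⟨h1, h2⟩ := le_val_of_mem_valuation hpat hR hj
      have h3 := (pow_dvd_pow (X - C (α j)) h1).trans
        (pow_dvd_of_keyEquation (R j).2 (hsol · j))
      exact dvd_sub (h3.mul_right _) (h2.mul_left _)
  · have hjv : j ∉ ξv := fun h1 => hj (Finset.mem_union_right _ h1)
    have hval := val_eq_polyVal hpat hu hR hjv
    obtain ⟨φ', hφ⟩ := pow_dvd_of_keyEquation (R j).2 (hsol · j)
    rw [hpat.outside j hj, ← red_eq_zero_iff,
      red_cross_eq hφ (hval ▸ pow_polyVal_dvd _ _ _) (hsol i j), residual_of_notMem hR hj i,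
      mul_zero]

theorem degree_locator (ξ : Finset (Fin n)) :
    (locator α lam ξ μ).degree = ((∑ j ∈ ξ, (lam j - μ j) : ℕ) : WithBot ℕ) := by
  simp [locator, degree_prod]

theorem natDegree_locator (ξ : Finset (Fin n)) :
    (locator α lam ξ μ).natDegree = ∑ j ∈ ξ, (lam j - μ j) :=
  natDegree_eq_of_degree_eq_some (degree_locator ξ)

theorem pow_dvd_locator (hpat : IsErrorPattern α lam h ξv ξe μ P) (j : Fin n) :
    (X - C (α j)) ^ (lam j - μ j) ∣ locator α lam ξv μ * locator α lam ξe μ := by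
  by_cases hj : j ∈ ξe ∪ ξv
  · rcases Finset.mem_union.mp hj with hj | hj
    · exact (Finset.dvd_prod_of_mem _ hj).mul_left _
    · exact (Finset.dvd_prod_of_mem _ hj).mul_right _
  · rw [hpat.outside j hj, Nat.sub_self, pow_zero]
    exact one_dvd _

theorem sum_precision_add (hpat : IsErrorPattern α lam h ξv ξe μ P) :
    ∑ j, μ j + (∑ j ∈ ξv, (lam j - μ j) + ∑ j ∈ ξe, (lam j - μ j)) = ∑ j, lam j := by
  classical
  rw [add_comm (∑ j ∈ ξv, _), ← Finset.sum_union hpat.disjoint,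
    Finset.sum_subset (Finset.subset_univ (ξe ∪ ξv))
      fun j _ hj => by rw [hpat.outside j hj, Nat.sub_self],
    ← Finset.sum_add_distrib]
  refine Finset.sum_congr rfl fun j _ => Nat.add_sub_cancel' ?_
  by_cases hj : j ∈ ξe ∪ ξv
  · rcases Finset.mem_union.mp hj with hj | hj
    · exact (hpat.evaluation j hj).2.le
    · exact (hpat.valuation j hj).2.le
  · exact (hpat.outside j hj).le

theorem natDegree_le_pred_of_degree_lt {p : F[X]} {k : ℕ} (hp : p.degree < (k : WithBot ℕ)) :
    p.natDegree ≤ k - 1 := by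
  rcases eq_or_ne p 0 with rfl | h0
  · simp
  · rw [degree_eq_natDegree h0] at hp
    norm_cast at hp
    omega

/-- If decoding fails, then some multiple of the family of errors is the reduction of a nonzero
vector of small degree, namely of `(φ f - ψ g) / ∏ (x - α_j)^(μ_j)` for a solution `(φ, ψ)`. -/
theorem hasSmallMultiple_of_decodingFails (hα : Function.Injective α)
    (hpat : IsErrorPattern α lam h ξv ξe μ P) {df dg tv te : ℕ} (hdf : 0 < df)
    (hf : ∀ i, (h.num i).degree < (df : WithBot ℕ)) (hg : h.den.degree < (dg : WithBot ℕ))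
    (hdegv : ∑ j ∈ ξv, (lam j - μ j) ≤ tv) (hdege : ∑ j ∈ ξe, (lam j - μ j) ≤ te)
    {u : ∀ j : {j // j ∈ ξe}, Fin ℓ → Trunc (α j) (lam j - μ j)} (hu : u ∈ errSet hpat)
    (hfail : DecodingFails df dg (tv + te) h (errWord α lam h ξv ξe μ P u)) :
    HasSmallMultiple (df + dg + (tv + te) - 1 - ∑ j, μ j) u := by
  obtain ⟨R, hR, o, ho, hne⟩ := hfail
  have hΛ0 : locator α lam ξv μ * locator α lam ξe μ ≠ 0 := by
    unfold locator
    exact mul_ne_zero (Finset.prod_ne_zero_iff.mpr fun _ _ => pow_ne_zero _ (X_sub_C_ne_zero _))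
      (Finset.prod_ne_zero_iff.mpr fun _ _ => pow_ne_zero _ (X_sub_C_ne_zero _))
  have hΛt : (locator α lam ξv μ * locator α lam ξe μ).degree ≤ ((tv + te : ℕ) : WithBot ℕ) := by
    rw [degree_mul, degree_locator, degree_locator]
    norm_cast
    omega
  have hΛ : (locator α lam ξv μ * locator α lam ξe μ * h.den,
      fun i => locator α lam ξv μ * locator α lam ξe μ * h.num i) ∈
      solutions df dg (tv + te) R := by
    have hlt : ∀ {p : F[X]} {d : ℕ}, p.degree < (d : WithBot ℕ) →
        (locator α lam ξv μ * locator α lam ξe μ * p).degree <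
          ((d + (tv + te) : ℕ) : WithBot ℕ) := by
      intro p d hp
      rcases eq_or_ne p 0 with rfl | h0
      · rw [mul_zero, degree_zero]
        exact WithBot.bot_lt_coe _
      · rw [degree_mul, degree_mul, degree_locator, degree_locator, degree_eq_natDegree h0]
        rw [degree_eq_natDegree h0] at hp
        norm_cast at hp ⊢
        omega
    refine ⟨fun i j => ?_, hlt hg, fun i => hlt (hf i)⟩
    obtain ⟨c, hc⟩ := pow_dvd_residual hpat hu hR j i
    obtain ⟨b, hb⟩ := pow_dvd_locator hpat j
    have hz : red (α j) (lam j) ((X - C (α j)) ^ (lam j - μ j)) *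
        red (α j) (lam j) ((X - C (α j)) ^ μ j) = 0 := by
      rw [← map_mul, ← pow_add, red_eq_zero_iff]
      exact pow_dvd_pow _ (by omega)
    change red (α j) (lam j) ((X - C (α j)) ^ ((R j).1.1 : ℕ) *
      (locator α lam ξv μ * locator α lam ξe μ * h.num i)) =
      red (α j) (lam j) (locator α lam ξv μ * locator α lam ξe μ * h.den) * (R j).1.2 i
    rw [hb, ← sub_eq_zero]
    simp only [map_mul] at hc hz ⊢
    linear_combination red (α j) (lam j) ((X - C (α j)) ^ (lam j - μ j)) *
      red (α j) (lam j) b * hc + red (α j) (lam j) b * c * hz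
  have hex : ∃ w ∈ solutions df dg (tv + te) R, ∃ i, w.1 * h.num i ≠ w.2 i * h.den := by
    by_contra! hall
    exact hne (decoderOutputs_eq_toRat h hf hg hall hΛ0 hΛt hΛ ho)
  obtain ⟨⟨φ, ψ⟩, ⟨hsol, hφd, hψd⟩, i₀, hi₀⟩ := hex
  have hN := fun i => prod_pow_dvd hα fun j => pow_dvd_cross hpat hu hR hsol j i
  choose E hE using hN
  have hN0 : ∏ j, (X - C (α j)) ^ μ j ≠ 0 := prod_pow_ne_zero α μ
  -- the multiplier at each evaluation error
  have hc : ∀ j : {j // j ∈ ξe}, ∃ c : Trunc (α j) (lam j - μ j), ∀ i,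
      c * u j i = red (α j) (lam j - μ j) (E i) := by
    intro j
    obtain ⟨b, hb⟩ := cross_eq hpat hu hR hsol j
    set N' := ∏ k ∈ Finset.univ.erase (j : Fin n), (X - C (α k)) ^ μ k with hN'
    have hNj : ∏ k, (X - C (α k)) ^ μ k = (X - C (α j)) ^ μ j * N' :=
      (Finset.mul_prod_erase _ _ (Finset.mem_univ _)).symm
    have hunit : IsUnit (red (α j) (lam j - μ j) N') := by
      refine isUnit_red (IsCoprime.prod_right fun k hk => IsCoprime.pow_right ?_)
      exact pairwise_coprime_X_sub_C hα (Finset.ne_of_mem_erase hk).symm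
    obtain ⟨w, hw⟩ := hunit.exists_left_inv
    refine ⟨w * red _ _ b, fun i => ?_⟩
    have h1 := hb i
    have h2 : (lam j : ℕ) = μ j + (lam j - μ j) := by
      have := (hpat.evaluation j j.2).2
      omega
    have h3 : (X - C (α j)) ^ μ (j : Fin n) * (X - C (α j)) ^ (lam j - μ j) ∣
        (X - C (α j)) ^ μ (j : Fin n) * (N' * E i - b * lift (u j i)) := by
      rw [← pow_add, ← h2, mul_sub, ← mul_assoc, ← hNj, ← hE i]
      exact h1
    rw [mul_dvd_mul_iff_left (pow_ne_zero _ (X_sub_C_ne_zero _)), ← red_eq_red_iff, map_mul,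
      map_mul, red_lift] at h3
    rw [mul_assoc, ← h3, ← mul_assoc, hw, one_mul]
  choose c hc using hc
  refine ⟨c, E, ?_, fun i => ?_, hc⟩
  · intro h0
    have := hE i₀
    rw [h0, Pi.zero_apply, mul_zero, sub_eq_zero] at this
    exact hi₀ this
  · rcases eq_or_ne (E i) 0 with h0 | h0
    · rw [h0, degree_zero]
      exact WithBot.bot_lt_coe _
    have h1 := natDegree_eq_of_degree_eq_some (degree_prod_pow α μ)
    have h2 := congrArg natDegree (hE i)
    rw [natDegree_mul hN0 h0, h1] at h2
    have h3 := natDegree_sub_le (φ * h.num i) (ψ i * h.den)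
    have h4 := natDegree_mul_le (p := φ) (q := h.num i)
    have h5 := natDegree_mul_le (p := ψ i) (q := h.den)
    have h6 := natDegree_le_pred_of_degree_lt hφd
    have h7 := natDegree_le_pred_of_degree_lt (hψd i)
    have h8 := natDegree_le_pred_of_degree_lt (hf i)
    have h9 := natDegree_le_pred_of_degree_lt hg
    have hdg : 0 < dg := by
      by_contra! h10
      rw [Nat.le_zero.mp h10, degree_eq_natDegree h.den_ne_zero] at hg
      norm_cast at hg
    rw [degree_eq_natDegree h0]
    norm_cast
    dsimp only at h2 h6 h7
    omega

end Failure

/-! ### The failure probability -/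

theorem rootMultiplicity_locator {F : Type*} [Field F] {n : ℕ} {α : Fin n → F}
    (hα : Function.Injective α) (lam : Fin n → ℕ) (ξ : Finset (Fin n)) (μ : Fin n → ℕ)
    {j : Fin n} (hj : j ∈ ξ) :
    (locator α lam ξ μ).rootMultiplicity (α j) = lam j - μ j := by
  classical
  have h0 : locator α lam ξ μ ≠ 0 :=
    Finset.prod_ne_zero_iff.mpr fun _ _ => pow_ne_zero _ (X_sub_C_ne_zero _)
  rw [← count_roots, locator, roots_prod _ _ h0, Multiset.count_bind]
  simp only [roots_pow, roots_X_sub_C, Multiset.count_nsmul, Multiset.count_singleton]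
  change ∑ k ∈ ξ, (lam k - μ k) * (if α j = α k then 1 else 0) = _
  simp [hα.eq_iff, hj]

theorem prod_roots_locator {F : Type*} [Field F] [DecidableEq F] {n : ℕ} {α : Fin n → F}
    (hα : Function.Injective α) {lam : Fin n → ℕ} {ξ : Finset (Fin n)} {μ : Fin n → ℕ}
    (hμ : ∀ j ∈ ξ, μ j < lam j) (c : ℕ → ℝ) :
    ∏ a ∈ (locator α lam ξ μ).roots.toFinset, c ((locator α lam ξ μ).rootMultiplicity a) =
      ∏ j : {j // j ∈ ξ}, c (lam j - μ j) := by
  have h0 : locator α lam ξ μ ≠ 0 :=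
    Finset.prod_ne_zero_iff.mpr fun _ _ => pow_ne_zero _ (X_sub_C_ne_zero _)
  have himg : (locator α lam ξ μ).roots.toFinset = ξ.image α := by
    ext a
    rw [Multiset.mem_toFinset, mem_roots h0, Finset.mem_image, locator, IsRoot.def, eval_prod,
      Finset.prod_eq_zero_iff]
    refine exists_congr fun j => and_congr_right fun hj => ?_
    have := Nat.sub_ne_zero_of_lt (hμ j hj)
    rw [eval_pow, pow_eq_zero_iff this, eval_sub, eval_X, eval_C, sub_eq_zero, eq_comm]
  rw [himg, Finset.prod_image hα.injOn, ← Finset.prod_coe_sort ξ fun j =>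
    c ((locator α lam ξ μ).rootMultiplicity (α j))]
  exact Finset.prod_congr rfl fun j _ => by rw [rootMultiplicity_locator hα _ _ _ j.2]

/-- The bound on the proportion of families with a small multiple, in terms of `t̄_e`. -/
theorem counting_bound_le {J : Type*} [Fintype J] {q : ℝ} (hq : 2 ≤ q) {ℓ : ℕ} {B L df dg tv te : ℕ}
    {e : J → ℕ} (hB : (B : ℝ) ≤ te + (∑ j, e j : ℕ) - ((L : ℝ) - df - dg + 1 - 2 * tv))
    (he : ∑ j, e j ≤ te) (hℓ : 0 < ℓ) :
    q ^ (B * ℓ) * ∏ j, ((q ^ e j - 1 / q ^ ℓ) / (q ^ (e j * ℓ) * (1 - 1 / q ^ ℓ))) ≤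
      q ^ (-((ℓ : ℝ) + 1) * (teBar ℓ L df dg tv - te)) *
        ∏ j, (1 - 1 / q ^ (ℓ + e j)) / (1 - 1 / q ^ ℓ) := by
  have hq0 : 0 < q := by linarith
  have hQ : 1 < q ^ ℓ := one_lt_pow₀ (by linarith) hℓ.ne'
  have hQ1 : 1 - 1 / q ^ ℓ ≠ 0 := by
    have : 1 / q ^ ℓ < 1 := (div_lt_one (by linarith)).mpr hQ
    linarith
  have hfac : ∀ j, (q ^ e j - 1 / q ^ ℓ) / (q ^ (e j * ℓ) * (1 - 1 / q ^ ℓ)) =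
      q ^ e j / (q ^ e j) ^ ℓ * ((1 - 1 / q ^ (ℓ + e j)) / (1 - 1 / q ^ ℓ)) := by
    intro j
    rw [div_mul_div_comm, ← pow_mul]
    congr 1
    rw [pow_add]
    field_simp
  simp_rw [hfac]
  rw [Finset.prod_mul_distrib, ← mul_assoc]
  refine mul_le_mul_of_nonneg_right ?_ (Finset.prod_nonneg fun j _ => div_nonneg ?_ ?_)
  · rw [Finset.prod_div_distrib, Finset.prod_pow, Finset.prod_pow_eq_pow_sum, ← pow_mul,
      ← Real.rpow_natCast, ← Real.rpow_natCast, ← Real.rpow_natCast, ← Real.rpow_sub hq0,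
      ← Real.rpow_add hq0]
    refine Real.rpow_le_rpow_of_exponent_le (by linarith) ?_
    have h1 : -((ℓ : ℝ) + 1) * (teBar ℓ L df dg tv - te) =
        ℓ * (te - ((L : ℝ) - df - dg + 1 - 2 * tv)) + te := by
      unfold teBar
      have : (ℓ : ℝ) + 1 ≠ 0 := by positivity
      field_simp
      ring
    rw [h1]
    have h2 : ((∑ j, e j : ℕ) : ℝ) ≤ te := by exact_mod_cast he
    have h3 : (0 : ℝ) ≤ ℓ := Nat.cast_nonneg _
    push_cast at h2 hB ⊢
    nlinarith [mul_le_mul_of_nonneg_left hB h3]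
  · rw [sub_nonneg, div_le_one (by positivity)]
    exact one_le_pow₀ (by linarith)
  · rw [sub_nonneg, div_le_one (by positivity)]
    exact hQ.le

theorem HasSmallMultiple.pos {F : Type*} [Field F] {J : Type*} {ℓ B : ℕ} {a : J → F}
    {e : J → ℕ} {u : ∀ j, Fin ℓ → Trunc (a j) (e j)} (hu : HasSmallMultiple B u) : 0 < B := by
  obtain ⟨c, E, hE, hdeg, -⟩ := hu
  obtain ⟨i, hi⟩ := Function.ne_iff.mp hE
  have h1 := hdeg i
  rw [degree_eq_natDegree hi] at h1
  norm_cast at h1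
  omega

section Final

variable {F : Type*} [Field F] {n ℓ : ℕ} {α : Fin n → F} {lam : Fin n → ℕ}
  {h : RedFrac F ℓ} {ξv ξe : Finset (Fin n)} {μ : Fin n → ℕ} {P : Word α lam ℓ}

open scoped Classical in
/-- The evaluation errors at which the reducedness of the received symbol restricts the error:
the denominator vanishes there and the error is of precision `μ_j = ν_{α_j}(g)`. -/
def restrictedPositions (α : Fin n → F) (lam : Fin n → ℕ) (h : RedFrac F ℓ)
    (ξe : Finset (Fin n)) (μ : Fin n → ℕ) : Finset {j // j ∈ ξe} :=
  Finset.univ.filter fun j => 0 < polyVal (α j) (lam j) h.den ∧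
    μ j - polyVal (α j) (lam j) h.den = 0

/-- Not all evaluation points are restricted, since the denominator would have too many zeros. -/
theorem card_restrictedPositions_lt [Fintype F] (hα : Function.Injective α)
    (hpat : IsErrorPattern α lam h ξv ξe μ P) (hsum : h.den.natDegree < ∑ j, μ j) :
    (restrictedPositions α lam h ξe μ).card < Fintype.card F := by
  classical
  by_contra! hle
  have hn : n ≤ Fintype.card F := by
    simpa using Fintype.card_le_of_injective α hα
  have huniv : (restrictedPositions α lam h ξe μ).map (Function.Embedding.subtype _) =
      Finset.univ := by
    refine Finset.eq_univ_of_card _ (le_antisymm (Finset.card_le_univ _) ?_)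
    rw [Finset.card_map, Fintype.card_fin]
    exact hn.trans hle
  have hμ : ∀ j, polyVal (α j) (lam j) h.den = μ j := by
    intro j
    have h1 : j ∈ (restrictedPositions α lam h ξe μ).map (Function.Embedding.subtype _) :=
      huniv ▸ Finset.mem_univ j
    obtain ⟨⟨k, hk⟩, h2, rfl⟩ := Finset.mem_map.mp h1
    have h3 : μ k - polyVal (α k) (lam k) h.den = 0 := (Finset.mem_filter.mp h2).2.2
    exact le_antisymm (hpat.evaluation k hk).1 (Nat.sub_eq_zero_iff_le.mp h3)
  have h1 : ∏ j, (X - C (α j)) ^ μ j ∣ h.den :=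
    prod_pow_dvd hα fun j => hμ j ▸ pow_polyVal_dvd _ _ _
  have h2 := natDegree_le_of_dvd h1 h.den_ne_zero
  rw [natDegree_eq_of_degree_eq_some (degree_prod_pow α μ)] at h2
  omega

theorem mem_errSet_iff (hlam : ∀ j, 0 < lam j) (hpat : IsErrorPattern α lam h ξv ξe μ P)
    (u : ∀ j : {j // j ∈ ξe}, Fin ℓ → Trunc (α j) (lam j - μ j)) :
    u ∈ errSet hpat ↔ ∀ j : {j // j ∈ ξe},
      (fun i => evalAt (Nat.sub_pos_of_lt (hpat.evaluation j j.2).2) (u j i)) ≠ 0 ∧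
      (j ∈ restrictedPositions α lam h ξe μ →
        (fun i => evalAt (Nat.sub_pos_of_lt (hpat.evaluation j j.2).2) (u j i)) ≠
          fun i => - evalAt (hlam j) (evRed h (α j) (lam j) i)) := by
  refine forall_congr' fun j => and_congr_right fun _ => ?_
  rw [isReducedSymb_errSymb_iff h (α j) (hlam j) (Nat.sub_pos_of_lt (hpat.evaluation j j.2).2)]
  simp [restrictedPositions]

end Final

end SRFPoles
end

open scoped Classical in
theorem theorem5 {F : Type*} [Field F] [Fintype F] {n ℓ : ℕ} (hℓ : 0 < ℓ)
    (α : Fin n → F) (hα : Function.Injective α)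
    (lam : Fin n → ℕ) (hlam : ∀ j, 0 < lam j)
    (L : ℕ) (hL : L = ∑ j, lam j)
    (df dg : ℕ) (hdf : 0 < df) (hdg : 0 < dg) (hdfdg : df + dg ≤ L + 1)
    (tv te : ℕ) (htv : (tv : ℤ) ≤ ⌊((L : ℝ) - df - dg + 1) / 2⌋)
    (hte : (te : ℝ) ≤ SRFPoles.teBar ℓ L df dg tv)
    (h : SRFPoles.RedFrac F ℓ)
    (hf : ∀ i, (h.num i).degree < (df : WithBot ℕ)) (hg : h.den.degree < (dg : WithBot ℕ))
    (ξv ξe : Finset (Fin n)) (μ : Fin n → ℕ) (P : SRFPoles.Word α lam ℓ)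
    (hpattern : SRFPoles.IsErrorPattern α lam h ξv ξe μ P)
    (Λv Λe : Polynomial F)
    (hΛv : Λv = SRFPoles.locator α lam ξv μ) (hΛe : Λe = SRFPoles.locator α lam ξe μ)
    (hdegv : Λv.natDegree ≤ tv) (hdege : Λe.natDegree ≤ te) :
    SRFPoles.uniformProb (SRFPoles.receivedSet α lam h ξv ξe μ P)
        (fun R => SRFPoles.DecodingFails df dg (tv + te) h R) ≤
      (Fintype.card F : ℝ) ^ (-((ℓ : ℝ) + 1) * (SRFPoles.teBar ℓ L df dg tv - te)) *
        ∏ a ∈ Λe.roots.toFinset,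
          (1 - 1 / (Fintype.card F : ℝ) ^ (ℓ + Λe.rootMultiplicity a)) /
            (1 - 1 / (Fintype.card F : ℝ) ^ ℓ) := by
  open SRFPoles in
  subst hΛv hΛe
  rw [natDegree_locator] at hdegv hdege
  set q : ℝ := (Fintype.card F : ℝ) with hq
  have hq2 : 2 ≤ q := by
    rw [hq]
    exact_mod_cast Fintype.one_lt_card (α := F)
  rw [prod_roots_locator hα (fun j hj => (hpattern.evaluation j hj).2)
    fun k => (1 - 1 / q ^ (ℓ + k)) / (1 - 1 / q ^ ℓ)]
  set rhs := q ^ (-((ℓ : ℝ) + 1) * (teBar ℓ L df dg tv - te)) *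
    ∏ j : {j // j ∈ ξe}, (1 - 1 / q ^ (ℓ + (lam j - μ j))) / (1 - 1 / q ^ ℓ) with hrhs
  have hrhs0 : 0 ≤ rhs := by
    have h1 : ∀ k, 0 ≤ 1 - 1 / q ^ k := by
      intro k
      rw [sub_nonneg, div_le_one (by positivity)]
      exact one_le_pow₀ (by linarith)
    exact mul_nonneg (Real.rpow_nonneg (by linarith) _)
      (Finset.prod_nonneg fun j _ => div_nonneg (h1 _) (h1 _))
  set B := df + dg + (tv + te) - 1 - ∑ j, μ j with hBdef
  set S : Finset (∀ j : {j // j ∈ ξe}, Fin ℓ → Trunc (α j) (lam j - μ j)) :=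
    (errSet hpattern).toFinset with hS
  -- transport to the families of errors
  have hcardB : (receivedSet α lam h ξv ξe μ P).ncard = S.card := by
    rw [← image_errWord hpattern, (injOn_errWord hpattern).ncard_image, hS,
      Set.ncard_eq_toFinset_card']
  have hcardA : {R ∈ receivedSet α lam h ξv ξe μ P | DecodingFails df dg (tv + te) h R}.ncard ≤
      (S.filter fun u => HasSmallMultiple B u).card := by
    rw [← Set.ncard_coe_finset]
    refine le_trans (Set.ncard_le_ncard ?_ (Set.toFinite _))
      (Set.ncard_image_le (f := errWord α lam h ξv ξe μ P) (Set.toFinite _))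
    rintro R ⟨hR, hfail⟩
    rw [← image_errWord hpattern] at hR
    obtain ⟨u, hu, rfl⟩ := hR
    refine ⟨u, Finset.mem_coe.mpr (Finset.mem_filter.mpr ⟨Set.mem_toFinset.mpr hu, ?_⟩), rfl⟩
    exact hasSmallMultiple_of_decodingFails hα hpattern hdf hf hg hdegv hdege hu hfail
  unfold uniformProb
  refine div_le_of_le_mul₀ (Nat.cast_nonneg _) hrhs0 ((Nat.cast_le.mpr hcardA).trans ?_)
  rw [hcardB]
  rcases (S.filter fun u => HasSmallMultiple B u).eq_empty_or_nonempty with h0 | ⟨u, hu⟩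
  · rw [h0, Finset.card_empty, Nat.cast_zero]
    exact mul_nonneg hrhs0 (Nat.cast_nonneg _)
  have hBpos : 0 < B := (Finset.mem_filter.mp hu).2.pos
  have hsum := sum_precision_add hpattern
  have hesum : ∑ j : {j // j ∈ ξe}, (lam j - μ j) = ∑ j ∈ ξe, (lam j - μ j) :=
    Finset.sum_coe_sort ξe fun j => lam j - μ j
  rw [← hL] at hsum
  have hBle : (B : ℝ) ≤ te + (∑ j : {j // j ∈ ξe}, (lam j - μ j) : ℕ) -
      ((L : ℝ) - df - dg + 1 - 2 * tv) := by
    have h1 : B + L + 1 ≤ df + dg + tv + te + tv + ∑ j ∈ ξe, (lam j - μ j) := by omega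
    rw [hesum]
    have h2 : ((B + L + 1 : ℕ) : ℝ) ≤
        ((df + dg + tv + te + tv + ∑ j ∈ ξe, (lam j - μ j) : ℕ) : ℝ) := Nat.cast_le.mpr h1
    rw [Nat.cast_add, Nat.cast_add, Nat.cast_add, Nat.cast_add, Nat.cast_add, Nat.cast_add,
      Nat.cast_add, Nat.cast_one] at h2
    linarith
  have hℓ0 : (0 : ℝ) < ℓ := Nat.cast_pos.mpr hℓ
  have hte' : ((ℓ : ℝ) + 1) * te ≤ ℓ * ((L : ℝ) - df - dg + 1 - 2 * tv) := by
    have h1 := hte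
    unfold teBar at h1
    rwa [div_mul_eq_mul_div, le_div_iff₀ (by positivity), mul_comm] at h1
  have hte0 : (0 : ℝ) ≤ te := Nat.cast_nonneg _
  have hteK : (te : ℝ) ≤ (L : ℝ) - df - dg + 1 - 2 * tv := by
    by_contra! h1
    nlinarith [mul_lt_mul_of_pos_left h1 hℓ0]
  have hBe : B ≤ ∑ j : {j // j ∈ ξe}, (lam j - μ j) := by
    have : (B : ℝ) ≤ (∑ j : {j // j ∈ ξe}, (lam j - μ j) : ℕ) := by linarith
    exact_mod_cast this
  have hde : ((∑ j : {j // j ∈ ξe}, (lam j - μ j) : ℕ) : ℝ) ≤ te := by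
    rw [hesum]
    exact_mod_cast hdege
  have hℓ2 : 2 ≤ ℓ := by
    by_contra! h1
    obtain rfl : ℓ = 1 := by omega
    have h2 : (0 : ℝ) < B := Nat.cast_pos.mpr hBpos
    rw [Nat.cast_one] at hte'
    linarith
  have hbad : (restrictedPositions α lam h ξe μ).card < Fintype.card F := by
    refine card_restrictedPositions_lt hα hpattern ?_
    have h1 := natDegree_le_pred_of_degree_lt hg
    omega
  have hmain := card_hasSmallMultiple_mem_le (a := fun j : {j // j ∈ ξe} => α j)
    (hα.comp Subtype.val_injective)
    (fun j : {j // j ∈ ξe} => Nat.sub_pos_of_lt (hpattern.evaluation j j.2).2) hBe hℓ2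
    (restrictedPositions α lam h ξe μ) hbad
    (fun j i => - evalAt (hlam j) (evRed h (α j) (lam j) i))
    (fun j hj h1 => evalAt_evRed_ne_zero h (α j) (hlam j) (Finset.mem_filter.mp hj).2.1
      (funext fun i => neg_eq_zero.mp (congrFun h1 i))) S
    (fun u => Set.mem_toFinset.trans (mem_errSet_iff hlam hpattern u))
  refine hmain.trans ?_
  rw [mul_comm]
  refine mul_le_mul_of_nonneg_right ?_ (Nat.cast_nonneg _)
  exact counting_bound_le hq2 hBle (hesum.trans_le hdege) hℓ
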